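/- Let $p$ be a prime, $k$ a perfect field of characteristic $p$, and $C$ a nonzero $k$-algebra isomorphic to $$B[x_1^{p^{-\infty}},\ldots,x_n^{p^{-\infty}}]/(x_1,\ldots,x_n)$$ for some $n\ge 0$ and some perfect $k$-algebra $B$ (here $B[x_1^{p^{-\infty}},\ldots,x_n^{p^{-\infty}}]$ is the perfection of $B[x_1,\ldots,x_n]$, i.e. the ring of finite sums $\sum_\alpha b_\alpha x^\alpha$ with $b_\alpha\in B$ and $\alpha\in\mathbb Z_+[1/p]^n$, where $\mathbb Z_+[1/p]=\{\alpha\in\mathbb Z[1/p] : \alpha\ge 0\}$). Let $C^\flat:=\varprojlim(\cdots\to C\to C\to C)$ be the inverse limit along the Frobenius of $C$, let $\nu_0:C^\flat\to C$ be the projection onto the last term, and let $A_{\mathrm{cris}}(C)$ be the $p$-adic completion of the divided power hull of the surjection $W(C^\flat)\to C$ induced by $\nu_0$, where $W$ denotes $p$-typical Witt vectors and the divided powers $\gamma_m$ are required to satisfy $\gamma_m(p)=p^m/m!$. Let $F:A_{\mathrm{cris}}(C)\to A_{\mathrm{cris}}(C)$ be the ring endomorphism induced by functoriality by the Frobenius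 of $C$, and for $c\in C^\flat$ let $[c]\in W(C^\flat)$ be its Teichmüller representative. Then the map $$\operatorname{Ker}\bigl((C^\flat)^\times\to C^\times\bigr)\to A_{\mathrm{cris}}(C),\qquad c\mapsto \log[c]:=-\sum_{n=1}^\infty (n-1)!\,\gamma_n(1-[c])$$ (the series converging $p$-adically) induces an isomorphism of groups from the multiplicative group $\operatorname{Ker}((C^\flat)^\times\to C^\times)$, where the homomorphism $(C^\flat)^\times\to C^\times$ is induced by $\nu_0$, onto the additive group $$A_{\mathrm{cris}}(C)^{F=p}:=\operatorname{Ker}\bigl(F-p:A_{\mathrm{cris}}(C)\to A_{\mathrm{cris}}(C)\bigr).$$ -/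

import Mathlib

universe u v

noncomputable section

open scoped Nat


/-! ### Divided power hulls over `(ℤ_(p), (p))` -/

namespace PDHull

variable {A : Type*} [CommRing A] (p : ℕ) (I : Ideal A)

/-- The defining relations of the divided power hull of `(A, I)`, where the variable `X (n, x)`
stands for the divided power `γ_n(x)` of an element `x ∈ I`: the relations of the universal divided
power algebra of the `A`-module `I`, the identification `γ_1(x) = x`, and the compatibility
`γ_n(p) = p ^ n / n!` with the divided powers of `ℤ_(p)`. In the last relation `a / b` is the
rational number `p ^ n / n!`, written with a denominator `b` that is prime to `p`. -/
inductive Rel : MvPolynomial (ℕ × I) A → MvPolynomial (ℕ × I) A → Prop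
  | zero (x : I) : Rel (MvPolynomial.X (0, x)) 1
  | one (x : I) : Rel (MvPolynomial.X (1, x)) (MvPolynomial.C (x : A))
  | smul (a : A) (n : ℕ) (x : I) :
      Rel (MvPolynomial.X (n, a • x)) (MvPolynomial.C (a ^ n) * MvPolynomial.X (n, x))
  | mul (m n : ℕ) (x : I) :
      Rel (MvPolynomial.X (m, x) * MvPolynomial.X (n, x))
        (((m + n).choose m : MvPolynomial (ℕ × I) A) * MvPolynomial.X (m + n, x))
  | add (n : ℕ) (x y : I) :
      Rel (MvPolynomial.X (n, x + y))
        (∑ k ∈ Finset.HasAntidiagonal.antidiagonal n, MvPolynomial.X (k.1, x) * MvPolynomial.X (k.2, y))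
  | compat (n a b : ℕ) (x : I) (hx : (x : A) = (p : A)) (hb : ¬ p ∣ b)
      (hab : n ! * a = b * p ^ n) :
      Rel ((b : MvPolynomial (ℕ × I) A) * MvPolynomial.X (n, x)) (a : MvPolynomial (ℕ × I) A)

/-- The ideal generated by the defining relations. -/
def relIdeal : Ideal (MvPolynomial (ℕ × I) A) :=
  Ideal.span {r | ∃ f g, Rel p I f g ∧ r = f - g}

end PDHull

/-- The divided power hull of an ideal `I` containing `p` in a `ℤ_(p)`-algebra `A`, with divided
powers compatible with those of `(p) ⊆ ℤ_(p)`: the quotient of the universal divided power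
algebra of the `A`-module `I` by the relations `γ_1(x) = x` (`x ∈ I`) and `γ_n(p) = p ^ n / n!`. -/
def PDHull {A : Type*} [CommRing A] (p : ℕ) (I : Ideal A) : Type _ :=
  MvPolynomial (ℕ × I) A ⧸ PDHull.relIdeal p I

namespace PDHull

section Basic

variable {A : Type*} [CommRing A] (p : ℕ) (I : Ideal A)

instance : CommRing (PDHull p I) :=
  inferInstanceAs (CommRing (MvPolynomial (ℕ × I) A ⧸ relIdeal p I))

/-- The projection from the polynomial ring. -/
def proj : MvPolynomial (ℕ × I) A →+* PDHull p I :=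
  Ideal.Quotient.mk (relIdeal p I)

/-- The canonical homomorphism `A → PDHull p I`. -/
def of : A →+* PDHull p I :=
  (proj p I).comp MvPolynomial.C

/-- The divided power `γ_n(x)` of an element `x ∈ I`, in the divided power hull. -/
def gamma (n : ℕ) (x : I) : PDHull p I :=
  proj p I (MvPolynomial.X (n, x))

variable {p I}

theorem proj_eq_of_rel {f g : MvPolynomial (ℕ × I) A} (h : Rel p I f g) :
    proj p I f = proj p I g :=
  Ideal.Quotient.eq.2 (Ideal.subset_span ⟨f, g, h, rfl⟩)

end Basic

section Map

variable {A A' : Type*} [CommRing A] [CommRing A'] (p : ℕ) {I : Ideal A} {I' : Ideal A'}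
  (f : A →+* A') (h : ∀ x ∈ I, f x ∈ I')

/-- The homomorphism from the polynomial ring inducing `PDHull.map`. -/
def preMap : MvPolynomial (ℕ × I) A →+* PDHull p I' :=
  MvPolynomial.eval₂Hom ((of p I').comp f) fun nx => gamma p I' nx.1 ⟨f nx.2, h nx.2 nx.2.2⟩

theorem preMap_eq_of_rel {r s : MvPolynomial (ℕ × I) A} (hr : Rel p I r s) :
    preMap p f h r = preMap p f h s := by
  cases hr with
  | zero x =>
    simpa [preMap, gamma] using proj_eq_of_rel (p := p) (Rel.zero (⟨f x, h x x.2⟩ : I'))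
  | one x =>
    simpa [preMap, gamma, of] using proj_eq_of_rel (p := p) (Rel.one (⟨f x, h x x.2⟩ : I'))
  | smul a n x =>
    have e : (⟨f (a • x : I), h _ (a • x : I).2⟩ : I') = f a • ⟨f x, h x x.2⟩ := by
      ext; simp
    have := proj_eq_of_rel (p := p) (Rel.smul (f a) n (⟨f x, h x x.2⟩ : I'))
    rw [← e] at this
    simpa [preMap, gamma, of] using this
  | mul m n x =>
    simpa [preMap, gamma] using proj_eq_of_rel (p := p) (Rel.mul m n (⟨f x, h x x.2⟩ : I'))
  | add n x y =>
    have e : (⟨f (x + y : I), h _ (x + y : I).2⟩ : I') = ⟨f x, h x x.2⟩ + ⟨f y, h y y.2⟩ := by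
      ext; simp
    have := proj_eq_of_rel (p := p) (Rel.add n (⟨f x, h x x.2⟩ : I') ⟨f y, h y y.2⟩)
    rw [← e] at this
    simpa [preMap, gamma] using this
  | compat n a b x hx hb hab =>
    simpa [preMap, gamma] using proj_eq_of_rel
      (Rel.compat n a b (⟨f x, h x x.2⟩ : I') (by simp [hx]) hb hab)

/-- Functoriality of the divided power hull: a homomorphism `f : A → A'` with `f(I) ⊆ I'` induces
a homomorphism of divided power hulls, with `γ_n(x) ↦ γ_n(f(x))`. -/
def map : PDHull p I →+* PDHull p I' :=
  Ideal.Quotient.lift (relIdeal p I) (preMap p f h) fun r hr => by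
    have hle : relIdeal p I ≤ RingHom.ker (preMap p f h) := by
      refine Ideal.span_le.2 ?_
      rintro _ ⟨s, t, hst, rfl⟩
      simp [RingHom.mem_ker, map_sub, preMap_eq_of_rel p f h hst]
    exact hle hr

theorem map_of (a : A) : map p f h (of p I a) = of p I' (f a) := by
  change preMap p f h (MvPolynomial.C a) = _
  simp [preMap]

theorem map_gamma (n : ℕ) (x : I) :
    map p f h (gamma p I n x) = gamma p I' n ⟨f x, h x x.2⟩ := by
  change preMap p f h (MvPolynomial.X (n, x)) = _
  simp [preMap]

end Map

end PDHull

/-! ### Fontaine's ring `A_cris(C)` -/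

section AcrisDef

variable (p : ℕ) [Fact p.Prime] (C : Type u) [CommRing C] [CharP C p]

/-- The ring homomorphism `W(C^♭) → C` induced by the projection `ν_0 : C^♭ → C`; here
`C^♭ = lim (⋯ → C → C)` (transition maps the Frobenius) is Mathlib's `Perfection C p`. -/
def wittToRing : WittVector p (Perfection C p) →+* C :=
  (Perfection.coeff C p 0).comp WittVector.constantCoeff

/-- The divided power hull of `W(C^♭) → C`. -/
abbrev AcrisHull : Type u :=
  PDHull p (RingHom.ker (wittToRing p C))

/-- `A_cris(C)`: the `p`-adic completion of the divided power hull of `W(C^♭) → C`. -/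
def Acris : Type u :=
  AdicCompletion (Ideal.span {(p : AcrisHull p C)}) (AcrisHull p C)

instance : CommRing (Acris p C) :=
  inferInstanceAs
    (CommRing (AdicCompletion (Ideal.span {(p : AcrisHull p C)}) (AcrisHull p C)))

end AcrisDef

namespace Acris

section Functoriality

variable (p : ℕ) [Fact p.Prime]

/-- The reduction `A_cris(C) → D / p ^ n D`, where `D` is the divided power hull. -/
def eval (C : Type u) [CommRing C] [CharP C p] (n : ℕ) :
    Acris p C →+* AcrisHull p C ⧸ Ideal.span {(p : AcrisHull p C)} ^ n :=
  (AdicCompletion.evalₐ (Ideal.span {(p : AcrisHull p C)}) n).toRingHom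

variable {C : Type u} {C' : Type v} [CommRing C] [CharP C p] [CommRing C'] [CharP C' p]
  (f : C →+* C')

/-- The homomorphism `W(C^♭) → W(C'^♭)` induced by `f : C → C'`. -/
def wittMap : WittVector p (Perfection C p) →+* WittVector p (Perfection C' p) :=
  WittVector.map (Perfection.map p f)

theorem wittMap_mem_ker (x : WittVector p (Perfection C p))
    (hx : x ∈ RingHom.ker (wittToRing p C)) :
    wittMap p f x ∈ RingHom.ker (wittToRing p C') := by
  have h0 : Perfection.coeff C p 0 (x.coeff 0) = 0 := hx
  change Perfection.coeff C' p 0 ((WittVector.map (Perfection.map p f) x).coeff 0) = 0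
  rw [WittVector.map_coeff, Perfection.coeff_map, h0, map_zero]

/-- The homomorphism of divided power hulls induced by `f : C → C'`. -/
def hullMap : AcrisHull p C →+* AcrisHull p C' :=
  PDHull.map p (wittMap p f) (wittMap_mem_ker p f)

theorem span_pow_le_comap (n : ℕ) :
    Ideal.span {(p : AcrisHull p C)} ^ n ≤
      (Ideal.span {(p : AcrisHull p C')} ^ n).comap (hullMap p f) := by
  rw [← Ideal.map_le_iff_le_comap, Ideal.map_pow, Ideal.map_span]
  simp

/-- The homomorphism `A_cris(C) → D' / p ^ n D'` induced by `f : C → C'`, where `D'` is the divided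
power hull attached to `C'`. -/
def mapAux (n : ℕ) : Acris p C →+* AcrisHull p C' ⧸ Ideal.span {(p : AcrisHull p C')} ^ n :=
  (Ideal.quotientMap _ (hullMap p f) (span_pow_le_comap p f n)).comp (eval p C n)

theorem factorPow_comp_mapAux {m n : ℕ} (hle : m ≤ n) :
    (Ideal.Quotient.factorPow (Ideal.span {(p : AcrisHull p C')}) hle).comp (mapAux p f n) =
      mapAux p f m := by
  ext x
  obtain ⟨y, hy⟩ := AdicCompletion.mk_surjective _ _ x
  have he : ∀ i, eval p C i x = Ideal.Quotient.mk _ (y i) := fun i => by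
    rw [← hy]
    exact AdicCompletion.evalₐ_mk _ i y
  simp only [mapAux, RingHom.comp_apply]
  rw [he, he, Ideal.quotientMap_mk, Ideal.quotientMap_mk]
  change Ideal.Quotient.mk _ (hullMap p f (y n)) = Ideal.Quotient.mk _ (hullMap p f (y m))
  rw [Ideal.Quotient.eq, ← map_sub]
  refine span_pow_le_comap p f m ?_
  exact Ideal.Quotient.eq.1 (AdicCompletion.Ideal.mk_eq_mk _ hle y)

/-- Functoriality of `A_cris`. -/
def map : Acris p C →+* Acris p C' :=
  AdicCompletion.liftRingHom (R := Acris p C) (Ideal.span {(p : AcrisHull p C')})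
    (mapAux p f) (factorPow_comp_mapAux p f)

theorem eval_map (n : ℕ) (x : Acris p C) :
    eval p C' n (map p f x) =
      Ideal.quotientMap _ (hullMap p f) (span_pow_le_comap p f n) (eval p C n x) :=
  AdicCompletion.evalₐ_liftRingHom _ (mapAux p f) (factorPow_comp_mapAux p f) n x

end Functoriality

variable (p : ℕ) [Fact p.Prime] (C : Type u) [CommRing C] [CharP C p]

/-- The endomorphism `F` of `A_cris(C)` induced by the Frobenius endomorphism of `C`. -/
def frob : Acris p C →+* Acris p C :=
  map p (frobenius C p)

/-- `A_cris(C)^{F = p}`, the kernel of the additive map `F - p`. -/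
def frobEqP : AddSubgroup (Acris p C) :=
  ((frob p C).toAddMonoidHom - AddMonoidHom.mulLeft (p : Acris p C)).ker

/-- `H(C)`, the kernel of `(C^♭)ˣ → Cˣ`. -/
def unitsKer : Subgroup (Perfection C p)ˣ :=
  (Units.map (Perfection.coeff C p 0 : Perfection C p →* C)).ker

variable {C}

/-- The element `1 - [c]` of the kernel of `W(C^♭) → C`, for `c ∈ H(C)`. -/
def oneSubTeich (c : unitsKer p C) : RingHom.ker (wittToRing p C) :=
  ⟨1 - WittVector.teichmuller p ((c : (Perfection C p)ˣ) : Perfection C p), by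
    have h : Perfection.coeff C p 0 ((c : (Perfection C p)ˣ) : Perfection C p) = 1 :=
      congrArg Units.val c.2
    rw [RingHom.mem_ker, map_sub, map_one]
    change 1 - Perfection.coeff C p 0 ((WittVector.teichmuller p _).coeff 0) = 0
    rw [WittVector.teichmuller_coeff_zero, h, sub_self]⟩

/-- The partial sum `-∑_{1 ≤ n ≤ N} (n - 1)! γ_n(1 - [c])` in the divided power hull. -/
def logPartialSum (c : unitsKer p C) (N : ℕ) : AcrisHull p C :=
  -∑ n ∈ Finset.Icc 1 N,
    ((n - 1)! : AcrisHull p C) * PDHull.gamma p (RingHom.ker (wittToRing p C)) n (oneSubTeich p c)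

/-- The terms of index greater than `p * N` of the series `log [c]` vanish modulo `p ^ N`. -/
theorem logPartialSum_sub_mem (c : unitsKer p C) (N M : ℕ) (h : p * N ≤ M) :
    logPartialSum p c (p * N) - logPartialSum p c M ∈
      Ideal.span {(p : AcrisHull p C)} ^ N := by
  induction M, h using Nat.le_induction with
  | base => simp
  | succ M hM ih =>
    have hs : logPartialSum p c (M + 1) = logPartialSum p c M -
        (M ! : AcrisHull p C) *
          PDHull.gamma p (RingHom.ker (wittToRing p C)) (M + 1) (oneSubTeich p c) := by
      unfold logPartialSum
      rw [Finset.sum_Icc_succ_top (by omega), neg_add, sub_eq_add_neg, Nat.add_sub_cancel]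
    have hd : p ^ N ∣ M ! := by
      have h1 : p ^ N ∣ (p !) ^ N :=
        pow_dvd_pow_of_dvd (Nat.dvd_factorial (Fact.out : p.Prime).pos le_rfl) N
      have h2 := Nat.prod_factorial_dvd_factorial_sum (Finset.range N) fun _ => p
      rw [Finset.prod_const, Finset.sum_const, Finset.card_range, smul_eq_mul,
        mul_comm N p] at h2
      exact (h1.trans h2).trans (Nat.factorial_dvd_factorial hM)
    have ht : (M ! : AcrisHull p C) ∈ Ideal.span {(p : AcrisHull p C)} ^ N := by
      rw [Ideal.span_singleton_pow, Ideal.mem_span_singleton]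
      exact_mod_cast Nat.cast_dvd_cast (α := AcrisHull p C) hd
    rw [hs, ← sub_add]
    exact Ideal.add_mem _ ih (Ideal.mul_mem_right _ _ ht)

/-- The element `log [c] = -∑_{n ≥ 1} (n - 1)! γ_n(1 - [c])` of `A_cris(C)`, for `c ∈ H(C)`. -/
def logTeich (c : unitsKer p C) : Acris p C :=
  AdicCompletion.mk (Ideal.span {(p : AcrisHull p C)}) (AcrisHull p C)
    (AdicCompletion.AdicCauchySequence.mk _ _ (fun N => logPartialSum p c (p * N)) fun N => by
      rw [SModEq.sub_mem, smul_eq_mul, Ideal.mul_top]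
      exact logPartialSum_sub_mem p c N _ (Nat.mul_le_mul_left p (Nat.le_succ N)))

/-- The partial sums of the series converge to `log [c]` in the `p`-adic topology. -/
theorem eval_logTeich (c : unitsKer p C) (N M : ℕ) (h : p * N ≤ M) :
    eval p C N (logTeich p c) = Ideal.Quotient.mk _ (logPartialSum p c M) := by
  have : eval p C N (logTeich p c) = Ideal.Quotient.mk _ (logPartialSum p c (p * N)) :=
    AdicCompletion.evalₐ_mk _ N _
  rw [this, Ideal.Quotient.eq]
  exact logPartialSum_sub_mem p c N M h

end Acris

/-! ### Good algebras -/

section Good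

/-- The monoid `ℤ_+[1/p]` of nonnegative rationals whose denominator is a power of `p`. -/
def padicExponents (p : ℕ) : AddSubmonoid ℚ where
  carrier := {q | ∃ m a : ℕ, q * (p : ℚ) ^ m = (a : ℚ)}
  zero_mem' := ⟨0, 0, by simp⟩
  add_mem' := by
    rintro x y ⟨m, a, hx⟩ ⟨n, b, hy⟩
    refine ⟨m + n, a * p ^ n + b * p ^ m, ?_⟩
    push_cast
    rw [← hx, ← hy]
    ring

theorem one_mem_padicExponents (p : ℕ) : (1 : ℚ) ∈ padicExponents p :=
  ⟨0, 1, by simp⟩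

variable (p : ℕ) (B : Type u) [CommRing B] (n : ℕ)

/-- The ring `B[x_1^{p^{-∞}}, …, x_n^{p^{-∞}}]` of finite sums `∑ b_α x^α`,
`α ∈ ℤ_+[1/p]^n`, `b_α ∈ B`. -/
abbrev PerfPolynomial : Type u :=
  AddMonoidAlgebra B (Fin n → padicExponents p)

/-- The variable `x_i`. -/
def perfVar (i : Fin n) : PerfPolynomial p B n :=
  AddMonoidAlgebra.single (Pi.single i ⟨1, one_mem_padicExponents p⟩) 1

/-- The ring `B[x_1^{p^{-∞}}, …, x_n^{p^{-∞}}] / (x_1, …, x_n)`. -/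
abbrev PerfPolynomialQuotient : Type u :=
  PerfPolynomial p B n ⧸ Ideal.span (Set.range (perfVar p B n))

/-- A `k`-algebra `C` is good if it is isomorphic to
`B[x_1^{p^{-∞}}, …, x_n^{p^{-∞}}] / (x_1, …, x_n)` for some `n` and some perfect
`k`-algebra `B`. -/
def IsGoodAlgebra (k : Type v) [Field k] (C : Type u) [CommRing C] [Algebra k C] : Prop :=
  ∃ (B : Type u) (_ : CommRing B) (_ : Algebra k B) (_ : PerfectRing B p) (n : ℕ),
    Nonempty (C ≃ₐ[k] PerfPolynomialQuotient p B n)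

end Good

end

/-! Let `D` be the divided power hull and `H` the kernel of `(C^♭)ˣ → Cˣ`. Modulo every power of
`p`, the elements `x^α / ⌊α⌋!` form a basis of `D` over `W(B)`. They span because the combinations
of them modulo `p` form a subring containing all generators (`mem_degFil_zero`). They are
independent because `D` maps to a `p`-torsion-free, `p`-adically complete ring in which they are
visibly independent (`exists_eq_smul_of_p_pow_dvd_psi`). Hence `A_cris(C)` has no `p`-torsion.

Torsion-freeness allows division by `p^m` in the congruence `[c]^q - 1 ≡ q log[c]` modulo `q^2`, `q
= p^m`. This exhibits `log[c]` as the limit of `([c]^q - 1) / q`, so the logarithm is a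
homomorphism. Then `F(log[c]) = log[c^p] = p log[c]`.

The Frobenius sends `x^α / ⌊α⌋!` to `ratio α` times `x^{pα} / ⌊pα⌋!`, and `p` divides `ratio α`
exactly when some entry of `α` is at least 1 (`α` is big). So modulo `p` a solution of `F = p` is
controlled by its coefficients on the fundamental domain of big `α` with all entries `< p`
(`p_dvd_of_mem_frobEqP`). There `⌊α⌋!` is prime to `p`, and `log[1 + r]` equals its linear part up
to terms of at least twice the degree (`logPartialSum_sub_psi_mem`).

Looking at the term of least degree, `p ∣ log[c]` forces `c` to be a `p`-th power in `H`; iterating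
gives injectivity. Conversely, matching leading terms doubles the degree of the error, and degrees
are bounded on the fundamental domain, so every solution is a logarithm modulo `p`. Correcting by
`p^m`-th powers, which are close to 1 in `C^♭`, gives surjectivity. -/

noncomputable section

open scoped Nat

/-! ### Identities and divisibilities between divided powers in the hull -/

namespace PDHull

section Relations

variable {A : Type*} [CommRing A] {p : ℕ} {I : Ideal A}

theorem gamma_zero (x : I) : gamma p I 0 x = 1 := by
  simpa [gamma] using proj_eq_of_rel (p := p) (Rel.zero x)

theorem gamma_one (x : I) : gamma p I 1 x = of p I x := by
  simpa [gamma, of] using proj_eq_of_rel (p := p) (Rel.one x)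

theorem gamma_smul (a : A) (n : ℕ) (x : I) :
    gamma p I n (a • x) = of p I a ^ n * gamma p I n x := by
  simpa [gamma, of] using proj_eq_of_rel (p := p) (Rel.smul a n x)

theorem gamma_mul (m n : ℕ) (x : I) :
    gamma p I m x * gamma p I n x = ((m + n).choose m : PDHull p I) * gamma p I (m + n) x := by
  simpa [gamma] using proj_eq_of_rel (p := p) (Rel.mul m n x)

theorem gamma_add (n : ℕ) (x y : I) :
    gamma p I n (x + y) =
      ∑ k ∈ Finset.HasAntidiagonal.antidiagonal n, gamma p I k.1 x * gamma p I k.2 y := by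
  simpa [gamma] using proj_eq_of_rel (p := p) (Rel.add n x y)

theorem gamma_compat (n a b : ℕ) (x : I) (hx : (x : A) = (p : A)) (hb : ¬ p ∣ b)
    (hab : n ! * a = b * p ^ n) : (b : PDHull p I) * gamma p I n x = a := by
  simpa [gamma] using proj_eq_of_rel (p := p) (Rel.compat n a b x hx hb hab)

theorem of_mul_gamma (m : ℕ) (x : I) :
    of p I x * gamma p I m x = ((m + 1 : ℕ) : PDHull p I) * gamma p I (m + 1) x := by
  rw [← gamma_one, gamma_mul, add_comm 1 m, Nat.choose_one_right]

theorem of_pow_mul_gamma (k m : ℕ) (x : I) :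
    of p I x ^ k * gamma p I m x =
      ((m + 1).ascFactorial k : PDHull p I) * gamma p I (m + k) x := by
  induction k with
  | zero => simp
  | succ k ih =>
    rw [pow_succ', mul_assoc, ih, mul_left_comm, of_mul_gamma, Nat.ascFactorial_succ]
    push_cast
    ring_nf

theorem factorial_mul_gamma (n : ℕ) (x : I) : (n ! : PDHull p I) * gamma p I n x = of p I x ^ n := by
  have h := of_pow_mul_gamma (p := p) n 0 x
  rw [gamma_zero, mul_one, zero_add, zero_add, Nat.one_ascFactorial] at h
  exact h.symm

/-- The divided powers of `p` of positive index are divisible by `p`. -/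
theorem dvd_gamma_of_eq_p [Fact p.Prime] {n : ℕ} (hn : n ≠ 0) (x : I) (hx : (x : A) = (p : A)) :
    (p : PDHull p I) ∣ gamma p I n x := by
  have hp : p.Prime := Fact.out
  obtain ⟨e, b, hb, hf⟩ := Nat.exists_eq_pow_mul_and_not_dvd (Nat.factorial_ne_zero n) p hp.ne_one
  -- By Legendre's bound `n - e` is positive, so the relation `b γ_n(p) = p^(n-e)` below has a right
  -- side divisible by `p`, with `b` prime to `p`.
  have he : e < n := by
    have h1 := padicValNat_factorial_lt_of_ne_zero p hn
    have h2 : padicValNat p (n !) = e := by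
      rw [hf, padicValNat.mul (pow_ne_zero _ hp.ne_zero) (by rintro rfl; simp at hb),
        padicValNat.prime_pow, padicValNat.eq_zero_of_not_dvd hb, add_zero]
    omega
  have h := gamma_compat (p := p) (I := I) n (p ^ (n - e)) b x hx hb (by
    rw [hf, mul_right_comm, ← pow_add, Nat.add_sub_cancel' he.le, mul_comm])
  have hc : IsCoprime (b : ℤ) (p : ℤ) :=
    Nat.isCoprime_iff_coprime.2 ((Nat.Prime.coprime_iff_not_dvd hp).2 hb).symm
  obtain ⟨s, t, hst⟩ := hc
  have hst' : (s : PDHull p I) * b + t * p = 1 := by exact_mod_cast congrArg (Int.cast (R := PDHull p I)) hst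
  have : gamma p I n x = (p : PDHull p I) * (s * (p : PDHull p I) ^ (n - e - 1) + t * gamma p I n x) := by
    calc gamma p I n x = (s * b + t * p) * gamma p I n x := by rw [hst', one_mul]
      _ = s * (b * gamma p I n x) + t * p * gamma p I n x := by ring
      _ = _ := by
        rw [h]
        obtain ⟨m, hm⟩ : ∃ m, n - e = m + 1 := ⟨n - e - 1, by omega⟩
        rw [hm, Nat.add_sub_cancel]
        push_cast
        ring
  exact ⟨_, this⟩

theorem dvd_gamma_p_smul [Fact p.Prime] {n : ℕ} (hn : n ≠ 0) (x : I) (hx : (p : A) ∣ (x : A))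
    (hI : (p : A) ∈ I) : (p : PDHull p I) ∣ gamma p I n x := by
  obtain ⟨z, hz⟩ := hx
  have : x = z • (⟨p, hI⟩ : I) := by ext; simp [hz, mul_comm]
  rw [this, gamma_smul]
  exact (dvd_gamma_of_eq_p hn _ rfl).mul_left _

/-- Writing `y^p = y^(p-1) • y` gives `γ_n(y^p) = y^(n(p-1)) γ_n(y)`, and each factor `y` raises the
index by one at the cost of an integer. This serves twice: for divisibility by `p`, and for the
Frobenius on divided powers of `[x_i]`. -/
theorem gamma_pow_p [Fact p.Prime] (n : ℕ) (x y : I) (hxy : (x : A) = (y : A) ^ p) :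
    gamma p I n x = ((n + 1).ascFactorial (n * (p - 1)) : PDHull p I) * gamma p I (p * n) y := by
  have hp : p.Prime := Fact.out
  have e : x = ((y : A) ^ (p - 1)) • y := by
    ext
    rw [hxy, Submodule.coe_smul, smul_eq_mul, ← pow_succ, Nat.sub_add_cancel hp.one_le]
  rw [e, gamma_smul, map_pow, ← pow_mul, mul_comm (p - 1) n, of_pow_mul_gamma]
  congr 2
  obtain ⟨q, hq⟩ : ∃ q, p = q + 1 := ⟨p - 1, (Nat.sub_add_cancel hp.one_le).symm⟩
  rw [hq, Nat.add_sub_cancel]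
  ring

/-- The last factor of `(n+1)(n+2)⋯(pn)` is `pn`. -/
theorem dvd_ascFactorial [Fact p.Prime] {n : ℕ} (hn : n ≠ 0) :
    p ∣ (n + 1).ascFactorial (n * (p - 1)) := by
  have hp : p.Prime := Fact.out
  obtain ⟨k, hk⟩ : ∃ k, n * (p - 1) = k + 1 :=
    ⟨n * (p - 1) - 1, by
      have : 0 < n * (p - 1) := Nat.mul_pos (Nat.pos_of_ne_zero hn) (by have := hp.two_le; omega)
      omega⟩
  have h : n + 1 + k = p * n := by
    have h2 : n * (p - 1) + n = p * n := by
      rw [← Nat.mul_succ, Nat.succ_eq_add_one, Nat.sub_add_cancel hp.one_le, mul_comm]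
    omega
  rw [hk, Nat.ascFactorial_succ, h]
  exact Dvd.dvd.mul_right (dvd_mul_right _ _) _

theorem dvd_gamma_pow_p [Fact p.Prime] {n : ℕ} (hn : n ≠ 0) (x y : I)
    (hxy : (x : A) = (y : A) ^ p) : (p : PDHull p I) ∣ gamma p I n x := by
  rw [gamma_pow_p n x y hxy]
  exact Dvd.dvd.mul_right (Nat.cast_dvd_cast (dvd_ascFactorial hn)) _

/-- Induction principle: a subring containing the image of `A` and all divided powers is
everything. -/
theorem mem_of_generators (S : Subring (PDHull p I)) (h1 : ∀ a, of p I a ∈ S)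
    (h2 : ∀ n x, gamma p I n x ∈ S) (d : PDHull p I) : d ∈ S := by
  obtain ⟨f, rfl⟩ : ∃ f, proj p I f = d := Ideal.Quotient.mk_surjective d
  induction f using MvPolynomial.induction_on with
  | C a => exact h1 a
  | add f g hf hg => rw [map_add]; exact S.add_mem hf hg
  | mul_X f nx hf => rw [map_mul]; exact S.mul_mem hf (h2 nx.1 nx.2)

end Relations

/-! ### Maps from the hull to torsion-free rings -/

section Lift

variable {A S : Type*} [CommRing A] [CommRing S] (p : ℕ) {I : Ideal A} (f : A →+* S)
  (hf : ∀ x ∈ I, ∀ n : ℕ, (n ! : S) ∣ f x ^ n)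

theorem cancel_natCast (hS : ∀ n : ℕ, n ≠ 0 → ∀ s : S, (n : S) * s = 0 → s = 0) {n : ℕ}
    (hn : n ≠ 0) {s t : S} (h : (n : S) * s = n * t) : s = t :=
  sub_eq_zero.1 (hS n hn _ (by rw [mul_sub, h, sub_self]))

/-- The homomorphism to a torsion-free ring, on the polynomial ring. -/
def preLift : MvPolynomial (ℕ × I) A →+* S :=
  MvPolynomial.eval₂Hom f fun nx => (hf nx.2 nx.2.2 nx.1).choose

theorem factorial_mul_preLift (n : ℕ) (x : I) :
    (n ! : S) * preLift f hf (MvPolynomial.X (n, x)) = f x ^ n := by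
  simpa [preLift] using (hf x x.2 n).choose_spec.symm

theorem preLift_C (a : A) : preLift f hf (MvPolynomial.C a) = f a := by simp [preLift]

/-- In a torsion-free ring a divided power is determined by its multiple by the factorial. Each
relation becomes an identity between ordinary powers after multiplication by factorials. -/
theorem preLift_eq_of_rel (hS : ∀ n : ℕ, n ≠ 0 → ∀ s : S, (n : S) * s = 0 → s = 0)
    {r s : MvPolynomial (ℕ × I) A} (hr : Rel p I r s) :
    preLift f hf r = preLift f hf s := by
  have key := factorial_mul_preLift f hf
  have hfac : ∀ n : ℕ, n ! ≠ 0 := Nat.factorial_ne_zero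
  cases hr with
  | zero x => simpa using key 0 x
  | one x => simpa [preLift_C] using key 1 x
  | smul a n x =>
    refine cancel_natCast hS (hfac n) ?_
    rw [key, map_mul, preLift_C, mul_left_comm, key]
    simp [mul_pow]
  | mul m n x =>
    refine cancel_natCast hS (mul_ne_zero (hfac m) (hfac n)) ?_
    rw [map_mul, map_mul, map_natCast]
    calc _ = ((m ! : S) * preLift f hf (MvPolynomial.X (m, x))) *
          ((n ! : S) * preLift f hf (MvPolynomial.X (n, x))) := by push_cast; ring
      _ = f x ^ (m + n) := by rw [key, key, pow_add]
      _ = _ := by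
        rw [← key, ← Nat.add_choose_mul_factorial_mul_factorial m n, ← Nat.choose_symm_add]
        push_cast
        ring
  | add n x y =>
    refine cancel_natCast hS (hfac n) ?_
    rw [key, map_sum, Finset.mul_sum, Submodule.coe_add, map_add, (Commute.all _ _).add_pow']
    refine Finset.sum_congr rfl fun k hk => ?_
    rw [Finset.HasAntidiagonal.mem_antidiagonal] at hk
    rw [← hk, nsmul_eq_mul, ← Nat.add_choose_mul_factorial_mul_factorial k.1 k.2, map_mul,
      ← key k.1 x, ← key k.2 y, ← Nat.choose_symm_add]
    push_cast
    ring
  | compat n a b x hx hb hab =>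
    refine cancel_natCast hS (hfac n) ?_
    rw [map_mul, map_natCast, map_natCast, mul_left_comm, key, hx, map_natCast]
    exact_mod_cast congrArg (Nat.cast (R := S)) hab.symm

/-- The universal property of the divided power hull for torsion-free target rings. -/
def lift (hS : ∀ n : ℕ, n ≠ 0 → ∀ s : S, (n : S) * s = 0 → s = 0) : PDHull p I →+* S :=
  Ideal.Quotient.lift (relIdeal p I) (preLift f hf) fun r hr => by
    have hle : relIdeal p I ≤ RingHom.ker (preLift f hf) := by
      refine Ideal.span_le.2 ?_
      rintro _ ⟨s, t, hst, rfl⟩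
      simp [RingHom.mem_ker, map_sub, preLift_eq_of_rel p f hf hS hst]
    exact hle hr

theorem lift_of (hS : ∀ n : ℕ, n ≠ 0 → ∀ s : S, (n : S) * s = 0 → s = 0) (a : A) :
    lift p f hf hS (of p I a) = f a := by
  change preLift f hf (MvPolynomial.C a) = _
  exact preLift_C f hf a

end Lift

end PDHull

/-! ### Torsion and divisibility in `p`-adic completions -/

namespace AdicCompletion

variable {S : Type*} [CommRing S] {p : ℕ}

theorem natCast_mem_span : (p : S) ∈ Ideal.span {(p : S)} := Ideal.mem_span_singleton_self _

theorem evalₐ_p_pow_mul (n : ℕ) (v : AdicCompletion (Ideal.span {(p : S)}) S) :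
    evalₐ (Ideal.span {(p : S)}) n ((p : AdicCompletion (Ideal.span {(p : S)}) S) ^ n * v) = 0 := by
  rw [map_mul, map_pow, map_natCast]
  have : ((p : S ⧸ Ideal.span {(p : S)} ^ n)) ^ n = 0 := by
    rw [← map_natCast (Ideal.Quotient.mk (Ideal.span {(p : S)} ^ n)), ← map_pow,
      Ideal.Quotient.eq_zero_iff_mem]
    exact Ideal.pow_mem_pow natCast_mem_span n
  rw [this, zero_mul]

theorem exists_eq_p_pow_mul {n : ℕ} {u : AdicCompletion (Ideal.span {(p : S)}) S}
    (hu : evalₐ (Ideal.span {(p : S)}) n u = 0) :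
    ∃ v, u = (p : AdicCompletion (Ideal.span {(p : S)}) S) ^ n * v := by
  have h1 : eval (Ideal.span {(p : S)}) S n u = 0 := by
    -- `evalₐ` takes values in the quotient by `I^n` and `eval` in the quotient by `I^n • ⊤`; these
    -- ideals coincide.
    have eq : Ideal.span {(p : S)} ^ n • (⊤ : Submodule S S) = Ideal.span {(p : S)} ^ n := by simp
    have hinj : Function.Injective (Ideal.Quotient.factor (le_of_eq eq)) := by
      rw [RingHom.injective_iff_ker_eq_bot, Ideal.Quotient.factor_ker]
      exact Ideal.map_mk_eq_bot_of_le (le_of_eq eq.symm)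
    exact hinj (hu.trans (_root_.map_zero (Ideal.Quotient.factor (le_of_eq eq))).symm)
  have h2 : u ∈ (eval (Ideal.span {(p : S)}) S n).ker := h1
  rw [← pow_smul_top_eq_ker_eval (Submodule.fg_span_singleton _), Ideal.span_singleton_pow,
    Submodule.ideal_span_singleton_smul] at h2
  obtain ⟨v, -, hv⟩ := Submodule.mem_smul_pointwise_iff_exists _ _ _ |>.1 h2
  refine ⟨v, ?_⟩
  rw [← hv, Algebra.smul_def, map_pow, map_natCast]

/-- The representative of `u` at level `N + 1` also represents `u` at level `N`, so losing one power
of `p` in the division is harmless. -/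
theorem eq_zero_of_p_mul (h : ∀ (N : ℕ) (d : S), (p : S) ^ (N + 1) ∣ p * d → (p : S) ^ N ∣ d)
    {u : AdicCompletion (Ideal.span {(p : S)}) S}
    (hu : (p : AdicCompletion (Ideal.span {(p : S)}) S) * u = 0) : u = 0 := by
  refine ext_evalₐ fun N => ?_
  obtain ⟨y, hy⟩ := AdicCompletion.mk_surjective _ _ u
  have he : ∀ i, evalₐ (Ideal.span {(p : S)}) i u = Ideal.Quotient.mk _ (y i) := fun i => by
    rw [← hy]
    exact AdicCompletion.evalₐ_mk _ i y
  rw [_root_.map_zero, he, ← AdicCompletion.Ideal.mk_eq_mk _ (Nat.le_succ N) y,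
    Ideal.Quotient.eq_zero_iff_mem, Ideal.span_singleton_pow, Ideal.mem_span_singleton]
  refine h N _ ?_
  have h2 := congrArg (evalₐ (Ideal.span {(p : S)}) (N + 1)) hu
  rw [map_mul, he, _root_.map_zero, map_natCast, ← map_natCast (Ideal.Quotient.mk _), ← map_mul,
    Ideal.Quotient.eq_zero_iff_mem, Ideal.span_singleton_pow, Ideal.mem_span_singleton] at h2
  exact h2

theorem isAdicComplete_span_p :
    IsAdicComplete (Ideal.span {(p : AdicCompletion (Ideal.span {(p : S)}) S)})
      (AdicCompletion (Ideal.span {(p : S)}) S) := by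
  have h := (IsAdicComplete.map_algebraMap_iff (S := AdicCompletion (Ideal.span {(p : S)}) S)
    (Ideal.span {(p : S)}) (AdicCompletion (Ideal.span {(p : S)}) S)).2
    (AdicCompletion.isAdicComplete (Submodule.fg_span_singleton _))
  rw [Ideal.map_span, Set.image_singleton, map_natCast] at h
  exact h

end AdicCompletion

theorem IsHausdorff.eq_zero_of_forall_p_pow_dvd {T : Type*} [CommRing T] {p : ℕ}
    [h : IsHausdorff (Ideal.span {(p : T)}) T] {s : T} (hs : ∀ N : ℕ, (p : T) ^ N ∣ s) : s = 0 := by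
  refine h.haus s fun N => ?_
  rw [SModEq.zero, smul_eq_mul, Ideal.mul_top, Ideal.span_singleton_pow,
    Ideal.mem_span_singleton]
  exact hs N

/-- The `p`-part of `n` is cancelled by hypothesis. A factor `b` prime to `p` is coprime to every
`p^N`, so `b s = 0` makes `s` divisible by all `p^N`. -/
theorem IsHausdorff.eq_zero_of_natCast_mul {T : Type*} [CommRing T] (p : ℕ) [Fact p.Prime]
    [IsHausdorff (Ideal.span {(p : T)}) T] (hT : ∀ s : T, (p : T) * s = 0 → s = 0) (n : ℕ)
    (hn : n ≠ 0) (s : T) (hs : (n : T) * s = 0) : s = 0 := by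
  have hp : p.Prime := Fact.out
  obtain ⟨e, b, hb, rfl⟩ := Nat.exists_eq_pow_mul_and_not_dvd hn p hp.ne_one
  have h1 : (b : T) * s = 0 := by
    clear hn
    induction e with
    | zero => simpa using hs
    | succ e ih =>
      refine ih (hT _ ?_)
      rw [← hs]
      push_cast
      ring
  refine IsHausdorff.eq_zero_of_forall_p_pow_dvd (p := p) fun N => ?_
  have hc : Nat.Coprime (p ^ N) b := Nat.Coprime.pow_left _ ((Nat.Prime.coprime_iff_not_dvd hp).2 hb)
  have hc' : IsCoprime ((p : T) ^ N) (b : T) := by exact_mod_cast hc.cast (R := T)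
  exact hc'.dvd_of_dvd_mul_left (by rw [h1]; exact dvd_zero _)

/-! ### Divisibility by `p` in Witt vectors of a perfect ring -/

section

variable {p : ℕ} [Fact p.Prime] {P : Type*} [CommRing P] [CharP P p] [PerfectRing P p]

theorem WittVector.p_dvd_iff (x : WittVector p P) : (p : WittVector p P) ∣ x ↔ x.coeff 0 = 0 := by
  rw [← Ideal.mem_span_singleton, mem_span_p_iff_coeff_zero_eq_zero]

theorem WittVector.p_dvd_sub_iff (x y : WittVector p P) :
    (p : WittVector p P) ∣ x - y ↔ x.coeff 0 = y.coeff 0 := by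
  rw [p_dvd_iff, ← WittVector.constantCoeff_apply, map_sub, sub_eq_zero]
  rfl

theorem WittVector.eq_zero_of_natCast_mul (n : ℕ) (hn : n ≠ 0) (x : WittVector p P)
    (hx : (n : WittVector p P) * x = 0) : x = 0 :=
  IsHausdorff.eq_zero_of_natCast_mul p
    (fun s hs => WittVector.eq_zero_of_p_mul_eq_zero s (by rwa [mul_comm])) n hn x hx

end

/-! ### Exponents -/

/-- The monoid of exponents `ℤ_+[1/p]^n`. -/
abbrev Expo (p n : ℕ) : Type := Fin n → padicExponents p

namespace Expo

section

variable {p : ℕ}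

theorem coe_nonneg [hp : Fact p.Prime] (q : padicExponents p) : (0 : ℚ) ≤ q := by
  obtain ⟨m, a, h⟩ := q.2
  have hpos : (0 : ℚ) < (p : ℚ) ^ m := pow_pos (by exact_mod_cast hp.out.pos) m
  by_contra hq
  have : (q : ℚ) * (p : ℚ) ^ m < 0 := mul_neg_of_neg_of_pos (not_le.1 hq) hpos
  rw [h] at this
  exact absurd this (not_lt.2 (Nat.cast_nonneg a))

theorem sub_natCast_mem {q : ℚ} (hq : q ∈ padicExponents p) {k : ℕ} (hk : (k : ℚ) ≤ q) :
    q - k ∈ padicExponents p := by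
  obtain ⟨m, a, h⟩ := hq
  have hle : k * p ^ m ≤ a := by
    have : (k : ℚ) * (p : ℚ) ^ m ≤ a := by
      rw [← h]
      exact mul_le_mul_of_nonneg_right hk (by positivity)
    exact_mod_cast this
  refine ⟨m, a - k * p ^ m, ?_⟩
  rw [Nat.cast_sub hle, sub_mul, h]
  push_cast
  ring

theorem div_p_mem [hp : Fact p.Prime] {q : ℚ} (hq : q ∈ padicExponents p) : q / p ∈ padicExponents p := by
  obtain ⟨m, a, h⟩ := hq
  refine ⟨m + 1, a, ?_⟩
  have : (p : ℚ) ≠ 0 := by exact_mod_cast hp.out.ne_zero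
  rw [← h]
  field_simp
  ring

end

variable {p : ℕ} {n : ℕ}

/-- The integral part of the `i`-th entry. -/
def fl (α : Expo p n) (i : Fin n) : ℕ := ⌊(α i : ℚ)⌋₊

/-- The product of the factorials of the integral parts. -/
def fact (α : Expo p n) : ℕ := ∏ i, (fl α i)!

/-- The total degree. -/
def deg (α : Expo p n) : ℚ := ∑ i, (α i : ℚ)

/-- A vector of natural numbers as an exponent. -/
def ofNat (ν : Fin n → ℕ) : Expo p n := fun i => ν i • ⟨1, one_mem_padicExponents p⟩

/-- Some entry is at least one. -/
def Big (α : Expo p n) : Prop := ∃ i, (1 : ℚ) ≤ α i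

theorem fact_ne_zero (α : Expo p n) : fact α ≠ 0 :=
  Finset.prod_ne_zero_iff.2 fun _ _ => Nat.factorial_ne_zero _

theorem ofNat_apply (ν : Fin n → ℕ) (i : Fin n) : ((ofNat ν : Expo p n) i : ℚ) = ν i := by
  simp [ofNat]

theorem nsmul_apply (k : ℕ) (α : Expo p n) (i : Fin n) : ((k • α) i : ℚ) = k * α i := by
  simp

theorem deg_add (α β : Expo p n) : deg (α + β) = deg α + deg β := by
  simp [deg, Finset.sum_add_distrib]

theorem deg_nsmul (k : ℕ) (α : Expo p n) : deg (k • α) = k * deg α := by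
  simp [deg, Finset.mul_sum]

theorem big_add_right {α : Expo p n} (h : Big α) [Fact p.Prime] (β : Expo p n) : Big (β + α) := by
  obtain ⟨i, hi⟩ := h
  refine ⟨i, hi.trans ?_⟩
  simpa using coe_nonneg (β i)

variable [hp : Fact p.Prime]

theorem deg_nonneg (α : Expo p n) : 0 ≤ deg α := Finset.sum_nonneg fun i _ => coe_nonneg (α i)

theorem one_le_deg {α : Expo p n} (h : Big α) : 1 ≤ deg α := by
  obtain ⟨i, hi⟩ := h
  exact hi.trans (Finset.single_le_sum (f := fun i => (α i : ℚ)) (fun i _ => coe_nonneg (α i))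
    (Finset.mem_univ i))

/-- The fractional part. -/
def frac (α : Expo p n) : Expo p n := fun i =>
  ⟨α i - fl α i, sub_natCast_mem (α i).2 (Nat.floor_le (coe_nonneg (α i)))⟩

theorem frac_apply (α : Expo p n) (i : Fin n) : (frac α i : ℚ) = α i - fl α i := rfl

theorem frac_add_fl (α : Expo p n) : frac α + ofNat (fl α) = α := by
  funext i
  refine Subtype.ext ?_
  rw [Pi.add_apply, AddSubmonoid.coe_add, frac_apply, ofNat_apply]
  ring

theorem fl_add_ofNat (α : Expo p n) (ν : Fin n → ℕ) : fl (α + ofNat ν) = fl α + ν := by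
  funext i
  rw [fl, Pi.add_apply, AddSubmonoid.coe_add, ofNat_apply, Nat.floor_add_natCast (coe_nonneg _)]
  rfl

theorem frac_add_ofNat (α : Expo p n) (ν : Fin n → ℕ) : frac (α + ofNat ν) = frac α := by
  funext i
  refine Subtype.ext ?_
  rw [frac_apply, frac_apply, fl_add_ofNat, Pi.add_apply, AddSubmonoid.coe_add, ofNat_apply,
    Pi.add_apply]
  push_cast
  ring

theorem fl_add_le (α β : Expo p n) (i : Fin n) : fl α i + fl β i ≤ fl (α + β) i := by
  refine Nat.le_floor ?_
  push_cast
  exact add_le_add (Nat.floor_le (coe_nonneg _)) (Nat.floor_le (coe_nonneg _))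

theorem fact_mul_fact_dvd (α β : Expo p n) : fact α * fact β ∣ fact (α + β) := by
  rw [fact, fact, ← Finset.prod_mul_distrib]
  exact Finset.prod_dvd_prod_of_dvd _ _ fun i _ =>
    (Nat.factorial_mul_factorial_dvd_factorial_add _ _).trans
      (Nat.factorial_dvd_factorial (fl_add_le α β i))

/-- Division by `p`. -/
def divP (α : Expo p n) : Expo p n := fun i => ⟨α i / p, div_p_mem (α i).2⟩

theorem divP_apply (α : Expo p n) (i : Fin n) : (divP α i : ℚ) = α i / p := rfl

theorem p_cast_pos : (0 : ℚ) < p := by exact_mod_cast hp.out.pos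

theorem smul_divP (α : Expo p n) : p • divP α = α := by
  funext i
  refine Subtype.ext ?_
  have := (p_cast_pos (p := p)).ne'
  rw [nsmul_apply, divP_apply]
  field_simp

theorem divP_smul (α : Expo p n) : divP (p • α) = α := by
  funext i
  refine Subtype.ext ?_
  have := (p_cast_pos (p := p)).ne'
  rw [divP_apply, nsmul_apply]
  field_simp

theorem smul_injective : Function.Injective fun α : Expo p n => p • α :=
  Function.LeftInverse.injective divP_smul

/-- The quotient `⌊pα⌋! / ⌊α⌋!`. -/
def ratio (α : Expo p n) : ℕ := ∏ i, (fl α i + 1).ascFactorial (fl (p • α) i - fl α i)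

theorem fl_le_fl_smul (α : Expo p n) (i : Fin n) : p * fl α i ≤ fl (p • α) i := by
  refine Nat.le_floor ?_
  rw [nsmul_apply]
  push_cast
  exact mul_le_mul_of_nonneg_left (Nat.floor_le (coe_nonneg _)) p_cast_pos.le

theorem fact_mul_ratio (α : Expo p n) : fact α * ratio α = fact (p • α) := by
  rw [fact, ratio, ← Finset.prod_mul_distrib]
  refine Finset.prod_congr rfl fun i _ => ?_
  rw [Nat.factorial_mul_ascFactorial, Nat.add_sub_cancel']
  exact (Nat.le_mul_of_pos_left _ hp.out.pos).trans (fl_le_fl_smul α i)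

theorem fact_eq_one {α : Expo p n} (h : ¬ Big α) : fact α = 1 := by
  refine Finset.prod_eq_one fun i _ => ?_
  have : fl α i = 0 := by
    by_contra h0
    exact h ⟨i, (Nat.one_le_cast.2 (Nat.one_le_iff_ne_zero.2 h0)).trans
      (Nat.floor_le (coe_nonneg _))⟩
  rw [this, Nat.factorial_zero]

theorem not_dvd_fact {α : Expo p n} (h : ∀ i, (α i : ℚ) < p) : ¬ p ∣ fact α := by
  intro hd
  obtain ⟨i, -, hi⟩ := (hp.out.prime.dvd_finsetProd_iff _).1 hd
  have h1 := (hp.out.dvd_factorial).1 hi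
  have h2 : (p : ℚ) ≤ α i := (Nat.cast_le.2 h1).trans (Nat.floor_le (coe_nonneg _))
  exact absurd h2 (not_le.2 (h i))

/-- Here `⌊α⌋! = 1`, and all entries of `pα` are below `p`, so no factor of `⌊pα⌋!` is a multiple of
`p`. -/
theorem not_dvd_ratio {α : Expo p n} (h : ¬ Big α) : ¬ p ∣ ratio α := by
  have h1 := fact_mul_ratio α
  rw [fact_eq_one h, one_mul] at h1
  rw [h1]
  refine not_dvd_fact fun i => ?_
  have : (α i : ℚ) < 1 := not_le.1 fun hi => h ⟨i, hi⟩
  rw [nsmul_apply]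
  exact mul_lt_of_lt_one_right p_cast_pos this

/-- At an entry with `⌊α_i⌋ ≥ 1` the product contains the block `(⌊α_i⌋ + 1)⋯(p⌊α_i⌋)`, which ends
in a multiple of `p`. This dichotomy between big and other exponents drives the analysis of `F = p`.
-/
theorem dvd_ratio {α : Expo p n} (h : Big α) : p ∣ ratio α := by
  obtain ⟨i, hi⟩ := h
  refine Dvd.dvd.trans ?_ (Finset.dvd_prod_of_mem _ (Finset.mem_univ i))
  have h1 : 1 ≤ fl α i := Nat.le_floor (by simpa using hi)
  have h2 := fl_le_fl_smul α i
  have h3 : fl α i * (p - 1) ≤ fl (p • α) i - fl α i := by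
    rw [Nat.mul_sub, mul_one, mul_comm]
    omega
  obtain ⟨k, hk⟩ := Nat.exists_eq_add_of_le h3
  rw [hk, ← Nat.ascFactorial_mul_ascFactorial]
  exact (PDHull.dvd_ascFactorial (by omega)).mul_right _

end Expo

/-! ### The perfect ring `B[x_1^{p^{-∞}}, …, x_n^{p^{-∞}}]` -/

namespace PerfPolynomial

section Perfect

variable {p : ℕ} [hp : Fact p.Prime] {B : Type u} [CommRing B] [CharP B p] {n : ℕ}

instance : CharP (PerfPolynomial p B n) p :=
  charP_of_injective_ringHom (f := (AddMonoidAlgebra.singleZeroRingHom : B →+* PerfPolynomial p B n))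
    (AddMonoidAlgebra.single_right_injective (M := Expo p n) (m := 0)) p

theorem coeff_pow_p (r : PerfPolynomial p B n) (α : Expo p n) :
    (r ^ p).coeff (p • α) = r.coeff α ^ p := by
  classical
  induction r using AddMonoidAlgebra.induction_linear with
  | zero => simp [hp.out.ne_zero]
  | add x y hx hy =>
    rw [add_pow_char, AddMonoidAlgebra.coeff_add, AddMonoidAlgebra.coeff_add, Finsupp.add_apply,
      Finsupp.add_apply, add_pow_char, hx, hy]
  | single β b =>
    rw [AddMonoidAlgebra.single_pow, AddMonoidAlgebra.coeff_single, AddMonoidAlgebra.coeff_single,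
      Finsupp.single_apply, Finsupp.single_apply]
    by_cases h : β = α
    · rw [if_pos h, if_pos (by rw [h])]
    · rw [if_neg h, if_neg fun e => h (Expo.smul_injective e), zero_pow hp.out.ne_zero]

variable [PerfectRing B p]

theorem single_eq_pow (α : Expo p n) (b : B) :
    (AddMonoidAlgebra.single α b : PerfPolynomial p B n) =
      AddMonoidAlgebra.single (Expo.divP α) ((frobeniusEquiv B p).symm b) ^ p := by
  rw [AddMonoidAlgebra.single_pow, Expo.smul_divP, frobeniusEquiv_symm_pow_p]

instance : PerfectRing (PerfPolynomial p B n) p where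
  bijective_frobenius := by
    constructor
    · change Function.Injective (frobenius (PerfPolynomial p B n) p)
      rw [injective_iff_map_eq_zero]
      intro r hr
      ext α
      have h := coeff_pow_p r α
      rw [← frobenius_def, hr] at h
      have h0 : r.coeff α ^ p = 0 ^ p := by
        rw [← h, zero_pow hp.out.ne_zero]
        simp
      simpa using injective_pow_p B p h0
    · change Function.Surjective (frobenius (PerfPolynomial p B n) p)
      intro r
      induction r using AddMonoidAlgebra.induction_linear with
      | zero => exact ⟨0, map_zero _⟩
      | add x y hx hy =>
        obtain ⟨a, rfl⟩ := hx
        obtain ⟨b, rfl⟩ := hy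
        exact ⟨a + b, map_add _ _ _⟩
      | single β b => exact ⟨_, (single_eq_pow β b).symm⟩

end Perfect

section Ideal

variable {p : ℕ} [hp : Fact p.Prime] {B : Type u} [CommRing B] {n : ℕ}

theorem mem_span_perfVar_iff (r : PerfPolynomial p B n) :
    r ∈ Ideal.span (Set.range (perfVar p B n)) ↔ ∀ α ∈ r.coeff.support, Expo.Big α := by
  classical
  have h : Set.range (perfVar p B n) = AddMonoidAlgebra.of' B (Expo p n) ''
      Set.range fun i => Pi.single i ⟨1, one_mem_padicExponents p⟩ := by
    rw [← Set.range_comp]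
    rfl
  rw [h, AddMonoidAlgebra.mem_ideal_span_of'_image]
  refine forall₂_congr fun α _ => ?_
  constructor
  · rintro ⟨_, ⟨i, rfl⟩, d, rfl⟩
    exact Expo.big_add_right ⟨i, by simp⟩ d
  · rintro ⟨i, hi⟩
    refine ⟨_, ⟨i, rfl⟩, Function.update α i
      ⟨α i - (1 : ℕ), Expo.sub_natCast_mem (α i).2 (by simpa using hi)⟩, ?_⟩
    funext j
    refine Subtype.ext ?_
    by_cases hj : j = i
    · subst hj
      simp
    · simp [hj]

end Ideal

end PerfPolynomial

/-! ### The homomorphism to the tilt -/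

namespace Perfection

variable {p : ℕ} [hp : Fact p.Prime] {C : Type u} [CommRing C] [CharP C p]

/-- A `p^m`-th root in the tilt shifts the sequence by `m` places. Thus an element whose `m`-th
coefficient is 0 (or 1) is the `p^m`-th power of one whose zeroth coefficient is 0 (or 1). -/
theorem exists_root (x : Perfection C p) (m : ℕ) :
    ∃ y : Perfection C p, y ^ p ^ m = x ∧ coeff C p 0 y = coeff C p m x := by
  refine ⟨(frobeniusEquiv _ p).symm^[m] x, ?_, ?_⟩
  · exact iterate_frobeniusEquiv_symm_pow_p_pow _ _ _ _
  · rw [coeff_iterate_symm_frobeniusEquiv, zero_add]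

theorem coeff_pow_p_pow (x : Perfection C p) (k m : ℕ) :
    coeff C p (k + m) (x ^ p ^ m) = coeff C p k x := by
  rw [← coeff_iterate_frobenius x k m, iterate_frobenius]

end Perfection

section Kernel

variable {p : ℕ} [hp : Fact p.Prime] {B : Type u} [CommRing B] {n : ℕ} {C : Type u} [CommRing C]
  (π : PerfPolynomial p B n →+* C)

theorem map_eq_zero_iff_big (hker : RingHom.ker π = Ideal.span (Set.range (perfVar p B n)))
    (r : PerfPolynomial p B n) :
    π r = 0 ↔ ∀ α ∈ r.coeff.support, Expo.Big α := by
  rw [← RingHom.mem_ker, hker, PerfPolynomial.mem_span_perfVar_iff]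

theorem map_single_eq_zero (hker : RingHom.ker π = Ideal.span (Set.range (perfVar p B n)))
    {α : Expo p n} (hα : Expo.Big α) (b : B) : π (AddMonoidAlgebra.single α b) = 0 := by
  classical
  rw [map_eq_zero_iff_big π hker]
  intro β hβ
  rw [AddMonoidAlgebra.coeff_single] at hβ
  rw [Finset.mem_singleton.1 (Finsupp.support_single_subset hβ)]
  exact hα

end Kernel

section Lam

variable {p : ℕ} [hp : Fact p.Prime] {B : Type u} [CommRing B] [CharP B p] [PerfectRing B p]
  {n : ℕ} {C : Type u} [CommRing C] [CharP C p] (π : PerfPolynomial p B n →+* C)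

/-- The homomorphism from the perfect ring `B[x_1^{p^{-∞}}, …, x_n^{p^{-∞}}]` to `C^♭`. -/
def lam : PerfPolynomial p B n →+* Perfection C p :=
  Perfection.lift p (PerfPolynomial p B n) C π

theorem coeff_zero_lam (r : PerfPolynomial p B n) : Perfection.coeff C p 0 (lam π r) = π r := rfl

theorem coeff_lam_pow (r : PerfPolynomial p B n) (m : ℕ) :
    Perfection.coeff C p m (lam π (r ^ p ^ m)) = π r := by
  have h := Perfection.coeff_pow_p_pow (lam π r) 0 m
  rw [zero_add, coeff_zero_lam] at h
  rw [map_pow, h]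

theorem exists_coeff_sub_lam_eq_zero (hπ : Function.Surjective π) (c : Perfection C p) (m : ℕ) :
    ∃ r, Perfection.coeff C p m (c - lam π r) = 0 := by
  obtain ⟨r, hr⟩ := hπ (Perfection.coeff C p m c)
  exact ⟨r ^ p ^ m, by rw [map_sub, coeff_lam_pow, hr, sub_self]⟩

/-- Every element of the kernel of `C^♭ → C` is congruent, modulo `p`-th powers of such elements, to
a combination of monomials with exponents in the fundamental domain. -/
theorem exists_small_representative (hπ : Function.Surjective π)
    (hker : RingHom.ker π = Ideal.span (Set.range (perfVar p B n)))
    (c : Perfection C p) (hc : Perfection.coeff C p 0 c = 0) :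
    ∃ r : PerfPolynomial p B n, Perfection.coeff C p 1 (c - lam π r) = 0 ∧
      ∀ α ∈ r.coeff.support, Expo.Big α ∧ ∀ i, (α i : ℚ) < p := by
  classical
  obtain ⟨r, hr⟩ := exists_coeff_sub_lam_eq_zero π hπ c 1
  have h0 : Perfection.coeff C p 0 (c - lam π r) = 0 := by
    rw [← Perfection.coeff_pow_p', hr, zero_pow hp.out.ne_zero]
  rw [map_sub, hc, zero_sub, neg_eq_zero, coeff_zero_lam, map_eq_zero_iff_big π hker] at h0
  let q : Expo p n → Prop := fun α => ∀ i, (α i : ℚ) < p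
  refine ⟨.ofCoeff (r.coeff.filter q), ?_, ?_⟩
  · have hsplit : r = .ofCoeff (r.coeff.filter q) + .ofCoeff (r.coeff.filter fun α => ¬ q α) := by
      rw [← AddMonoidAlgebra.ofCoeff_add, Finsupp.filter_add_filter_not]
    have hrest : Perfection.coeff C p 1
        (lam π (.ofCoeff (r.coeff.filter fun α => ¬ q α))) = 0 := by
      rw [← AddMonoidAlgebra.sum_coeff_single (.ofCoeff (r.coeff.filter fun α => ¬ q α)),
        Finsupp.sum, map_sum, map_sum]
      refine Finset.sum_eq_zero fun α hα => ?_
      have hα' : ¬ q α := by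
        have h1 : α ∈ (r.coeff.filter fun α => ¬ q α).support := hα
        rw [Finsupp.support_filter, Finset.mem_filter] at h1
        exact h1.2
      obtain ⟨i, hi⟩ := not_forall.1 hα'
      -- The term `b x^α` is the `p`-th power of `b^{1/p} x^{α/p}`, and `α/p` is big because `α_i ≥
      -- p`; so its coefficient at index 1 vanishes.
      have h1 := coeff_lam_pow π (AddMonoidAlgebra.single (Expo.divP α)
        ((frobeniusEquiv B p).symm ((AddMonoidAlgebra.ofCoeff
          (r.coeff.filter fun α => ¬ q α)).coeff α))) 1
      rw [pow_one, ← PerfPolynomial.single_eq_pow, map_single_eq_zero π hker] at h1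
      · exact h1
      · refine ⟨i, ?_⟩
        rw [Expo.divP_apply, le_div_iff₀ Expo.p_cast_pos, one_mul]
        exact not_lt.1 hi
    rw [hsplit, map_add, ← sub_sub, map_sub, hrest, sub_zero] at hr
    exact hr
  · intro α hα
    have h1 : α ∈ (r.coeff.filter q).support := hα
    rw [Finsupp.support_filter, Finset.mem_filter] at h1
    exact ⟨h0 α h1.1, h1.2⟩

end Lam

open PDHull

/-! ### A spanning family of the divided power hull modulo `p` -/

/-- A presentation of `C` as `B[x_1^{p^{-∞}}, …, x_n^{p^{-∞}}] / (x_1, …, x_n)`. -/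
class IsGoodPresentation {p : ℕ} {B : Type u} [CommRing B] {n : ℕ} {C : Type u} [CommRing C]
    (π : PerfPolynomial p B n →+* C) : Prop where
  surjective : Function.Surjective π
  ker_eq : RingHom.ker π = Ideal.span (Set.range (perfVar p B n))

/-- The kernel of `W(C^♭) → C`. -/
abbrev AcrisIdeal (p : ℕ) [Fact p.Prime] (C : Type u) [CommRing C] [CharP C p] :
    Ideal (WittVector p (Perfection C p)) :=
  RingHom.ker (wittToRing p C)

section AcrisIdeal

variable {p : ℕ} [hp : Fact p.Prime] {C : Type u} [CommRing C] [CharP C p]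

theorem mem_acrisIdeal_iff (x : WittVector p (Perfection C p)) :
    x ∈ AcrisIdeal p C ↔ Perfection.coeff C p 0 (x.coeff 0) = 0 := Iff.rfl

theorem p_mem_acrisIdeal : (p : WittVector p (Perfection C p)) ∈ AcrisIdeal p C := by
  rw [RingHom.mem_ker, map_natCast, CharP.cast_eq_zero]

theorem teichmuller_mem_acrisIdeal {c : Perfection C p} (hc : Perfection.coeff C p 0 c = 0) :
    WittVector.teichmuller p c ∈ AcrisIdeal p C := by
  rw [mem_acrisIdeal_iff, WittVector.teichmuller_coeff_zero, hc]

theorem p_dvd_of_pow (y : AcrisIdeal p C) :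
    (p : AcrisHull p C) ∣ of p (AcrisIdeal p C) y ^ p := by
  rw [← factorial_mul_gamma]
  exact Dvd.dvd.mul_right (Nat.cast_dvd_cast (Nat.dvd_factorial hp.out.pos le_rfl)) _

end AcrisIdeal

section Exponents

variable {p : ℕ} {n : ℕ}

/-- The exponent of the variable `x_i`. -/
def unitExpo (p : ℕ) {n : ℕ} (i : Fin n) : Expo p n := Pi.single i ⟨1, one_mem_padicExponents p⟩

theorem ofNat_eq_sum (ν : Fin n → ℕ) : Expo.ofNat ν = ∑ i, ν i • unitExpo p i := by
  funext j
  simp only [Expo.ofNat, Finset.sum_apply, Pi.smul_apply, unitExpo]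
  rw [Finset.sum_eq_single j (fun i _ hi => by rw [Pi.single_eq_of_ne hi.symm, smul_zero])
    (fun h => absurd (Finset.mem_univ j) h), Pi.single_eq_same]

theorem big_unitExpo (i : Fin n) : Expo.Big (unitExpo p i) := ⟨i, by simp [unitExpo]⟩

end Exponents

section Span

variable {p : ℕ} [hp : Fact p.Prime] {B : Type u} [CommRing B] [CharP B p] [PerfectRing B p]
  {n : ℕ} {C : Type u} [CommRing C] [CharP C p] (π : PerfPolynomial p B n →+* C)

/-- The homomorphism `W(B) → W(C^♭)`. -/
def iotaW : WittVector p B →+* WittVector p (Perfection C p) :=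
  WittVector.map ((lam π).comp AddMonoidAlgebra.singleZeroRingHom)

/-- The Teichmüller representatives of monomials. -/
def monoHom : Multiplicative (Expo p n) →* WittVector p (Perfection C p) :=
  (WittVector.teichmuller p).comp ((lam π : PerfPolynomial p B n →* Perfection C p).comp
    (AddMonoidAlgebra.of B (Expo p n)))

/-- The Teichmüller representative of the monomial `x^α`. -/
def mono (α : Expo p n) : WittVector p (Perfection C p) := monoHom π (Multiplicative.ofAdd α)

theorem mono_def (α : Expo p n) :
    mono π α = WittVector.teichmuller p (lam π (AddMonoidAlgebra.single α 1)) := rfl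

theorem mono_zero : mono π 0 = 1 := map_one (monoHom π)

theorem mono_add (α β : Expo p n) : mono π (α + β) = mono π α * mono π β :=
  map_mul (monoHom π) _ _

theorem mono_nsmul (k : ℕ) (α : Expo p n) : mono π (k • α) = mono π α ^ k :=
  map_pow (monoHom π) _ _

theorem mono_ofNat (ν : Fin n → ℕ) : mono π (Expo.ofNat ν) = ∏ i, mono π (unitExpo p i) ^ ν i := by
  rw [ofNat_eq_sum, mono, ofAdd_sum, map_prod]
  exact Finset.prod_congr rfl fun i _ => mono_nsmul π _ _

theorem teichmuller_lam_single (α : Expo p n) (b : B) :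
    WittVector.teichmuller p (lam π (AddMonoidAlgebra.single α b)) =
      iotaW π (WittVector.teichmuller p b) * mono π α := by
  rw [mono_def, iotaW, WittVector.map_teichmuller, ← map_mul, RingHom.comp_apply, ← map_mul]
  congr 2
  simp [AddMonoidAlgebra.single_mul_single]

/-- The Teichmüller expansion, modulo `p`, of an element of the tilt. -/
theorem coeff_zero_sum (r : PerfPolynomial p B n) :
    (∑ α ∈ r.coeff.support,
      iotaW π (WittVector.teichmuller p (r.coeff α)) * mono π α).coeff 0 = lam π r := by
  rw [← WittVector.constantCoeff_apply, map_sum]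
  conv_rhs => rw [← AddMonoidAlgebra.sum_coeff_single r, Finsupp.sum, map_sum]
  refine Finset.sum_congr rfl fun α _ => ?_
  rw [← teichmuller_lam_single, WittVector.constantCoeff_apply, WittVector.teichmuller_coeff_zero]

/-- An element of `W(C^♭)` is a sum of monomials, up to multiples of `p` and `p`-th powers. -/
theorem exists_witt_decomposition (x : WittVector p (Perfection C p)) (r : PerfPolynomial p B n)
    (hr : Perfection.coeff C p 1 (x.coeff 0 - lam π r) = 0) :
    ∃ (t : AcrisIdeal p C) (z : WittVector p (Perfection C p)),
      x = ∑ α ∈ r.coeff.support, iotaW π (WittVector.teichmuller p (r.coeff α)) * mono π α +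
        (t : WittVector p (Perfection C p)) ^ p + p * z := by
  -- The zeroth coefficient of the root `s` is the first coefficient of the error, which vanishes;
  -- hence `[s]` lies in the kernel.
  obtain ⟨s, hs, hs0⟩ := Perfection.exists_root (x.coeff 0 - lam π r) 1
  rw [pow_one] at hs
  refine ⟨⟨WittVector.teichmuller p s, teichmuller_mem_acrisIdeal (hs0.trans hr)⟩, ?_⟩
  obtain ⟨z, hz⟩ : (p : WittVector p (Perfection C p)) ∣
      x - (∑ α ∈ r.coeff.support, iotaW π (WittVector.teichmuller p (r.coeff α)) * mono π α +
        (WittVector.teichmuller p s) ^ p) := by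
    rw [WittVector.p_dvd_sub_iff, ← WittVector.constantCoeff_apply, ← WittVector.constantCoeff_apply,
      map_add, WittVector.constantCoeff_apply, WittVector.constantCoeff_apply, coeff_zero_sum,
      ← map_pow, WittVector.constantCoeff_apply, WittVector.teichmuller_coeff_zero, hs]
    ring
  exact ⟨z, by rw [← hz]; ring⟩

variable [hgp : IsGoodPresentation π]

theorem mono_mem {α : Expo p n} (hα : Expo.Big α) : mono π α ∈ AcrisIdeal p C :=
  teichmuller_mem_acrisIdeal (map_single_eq_zero π hgp.ker_eq hα 1)

/-- The Teichmüller representative of `x_i`, as an element of the kernel of `W(C^♭) → C`. -/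
def xker (i : Fin n) : AcrisIdeal p C := ⟨mono π (unitExpo p i), mono_mem π (big_unitExpo i)⟩

/-- The element `x^α / ⌊α⌋!` of the divided power hull. -/
def basisElt (α : Expo p n) : AcrisHull p C :=
  of p (AcrisIdeal p C) (mono π (Expo.frac α)) *
    ∏ i, gamma p (AcrisIdeal p C) (Expo.fl α i) (xker π i)

/-- The map sending a family of coefficients to the corresponding combination of the elements
`x^α / ⌊α⌋!`. -/
def psi : (Expo p n →₀ WittVector p B) →+ AcrisHull p C :=
  Finsupp.liftAddHom fun α =>
    (AddMonoidHom.mulRight (basisElt π α)).comp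
      ((of p (AcrisIdeal p C)).comp (iotaW π)).toAddMonoidHom

theorem psi_single (α : Expo p n) (a : WittVector p B) :
    psi π (Finsupp.single α a) = of p (AcrisIdeal p C) (iotaW π a) * basisElt π α :=
  Finsupp.liftAddHom_apply_single _ _ _

/-- Split `x^β` into its fractional part and `∏ x_i^⌊β_i⌋`, then absorb each power of `x_i` into the
divided power of the same variable. Products, powers and Frobenius images of basis elements all
reduce to this formula. -/
theorem of_mono_mul_prod (β : Expo p n) (ν : Fin n → ℕ) :
    of p (AcrisIdeal p C) (mono π β) * ∏ i, gamma p (AcrisIdeal p C) (ν i) (xker π i) =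
      ((∏ i, (ν i + 1).ascFactorial (Expo.fl β i) : ℕ) : AcrisHull p C) *
        basisElt π (β + Expo.ofNat ν) := by
  conv_lhs => rw [← Expo.frac_add_fl β, mono_add, mono_ofNat, map_mul, map_prod, mul_assoc,
    ← Finset.prod_mul_distrib]
  rw [basisElt, Expo.frac_add_ofNat, Expo.fl_add_ofNat, mul_left_comm, Nat.cast_prod,
    ← Finset.prod_mul_distrib]
  refine congrArg _ (Finset.prod_congr rfl fun i _ => ?_)
  rw [map_pow, Pi.add_apply, add_comm (Expo.fl β i)]
  exact of_pow_mul_gamma (Expo.fl β i) (ν i) (xker π i)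

theorem of_mono (β : Expo p n) :
    of p (AcrisIdeal p C) (mono π β) = (Expo.fact β : AcrisHull p C) * basisElt π β := by
  have h := of_mono_mul_prod π β 0
  have h0 : Expo.ofNat (0 : Fin n → ℕ) = (0 : Expo p n) := by
    rw [ofNat_eq_sum]
    simp
  have h1 : ∏ i, gamma p (AcrisIdeal p C) ((0 : Fin n → ℕ) i) (xker π i) = 1 :=
    Finset.prod_eq_one fun i _ => gamma_zero _
  rw [h0, add_zero, h1, mul_one] at h
  simp only [Pi.zero_apply, zero_add, Nat.one_ascFactorial] at h
  exact h

theorem basisElt_mul (α β : Expo p n) :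
    ∃ k : ℕ, basisElt π α * basisElt π β = (k : AcrisHull p C) * basisElt π (α + β) := by
  have h1 : Expo.frac α + Expo.frac β + Expo.ofNat (Expo.fl α + Expo.fl β) = α + β := by
    funext i
    refine Subtype.ext ?_
    simp only [Pi.add_apply, AddSubmonoid.coe_add, Expo.frac_apply, Expo.ofNat_apply]
    push_cast
    ring
  refine ⟨(∏ i, (Expo.fl α i + Expo.fl β i).choose (Expo.fl α i)) *
    ∏ i, ((Expo.fl α + Expo.fl β) i + 1).ascFactorial (Expo.fl (Expo.frac α + Expo.frac β) i), ?_⟩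
  rw [Nat.cast_mul, mul_assoc, ← h1, ← of_mono_mul_prod, basisElt, basisElt, mul_mul_mul_comm,
    ← map_mul, ← mono_add, ← Finset.prod_mul_distrib, mul_left_comm]
  refine congrArg _ ?_
  rw [Nat.cast_prod, ← Finset.prod_mul_distrib]
  exact Finset.prod_congr rfl fun i _ => gamma_mul _ _ _

theorem basisElt_zero : basisElt π 0 = 1 := by
  have h := of_mono π 0
  rw [mono_zero, map_one, Expo.fact_eq_one, Nat.cast_one, one_mul] at h
  · exact h.symm
  · rintro ⟨i, hi⟩
    simp at hi
    exact absurd hi (by norm_num)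

/-- The subgroup of elements congruent modulo `p` to a combination of the `x^α / ⌊α⌋!` with
`deg α ≥ d`. -/
def degFil (d : ℚ) : AddSubgroup (AcrisHull p C) where
  carrier := {x | ∃ z, (∀ α, Expo.deg α < d → z α = 0) ∧ (p : AcrisHull p C) ∣ x - psi π z}
  zero_mem' := ⟨0, fun _ _ => rfl, by simp⟩
  add_mem' := by
    rintro x y ⟨z, hz, hx⟩ ⟨w, hw, hy⟩
    refine ⟨z + w, fun α hα => by rw [Finsupp.add_apply, hz α hα, hw α hα, add_zero], ?_⟩
    rw [map_add, add_sub_add_comm]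
    exact dvd_add hx hy
  neg_mem' := by
    rintro x ⟨z, hz, hx⟩
    refine ⟨-z, fun α hα => by rw [Finsupp.neg_apply, hz α hα, neg_zero], ?_⟩
    rw [map_neg, ← neg_sub', dvd_neg]
    exact hx

theorem mem_degFil_of_dvd {d : ℚ} {x : AcrisHull p C} (h : (p : AcrisHull p C) ∣ x) :
    x ∈ degFil π d := ⟨0, fun _ _ => rfl, by simpa using h⟩

theorem mem_degFil_of_dvd_sub {d : ℚ} {x y : AcrisHull p C} (h : (p : AcrisHull p C) ∣ x - y)
    (hy : y ∈ degFil π d) : x ∈ degFil π d := by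
  rw [← sub_add_cancel x y]
  exact add_mem (mem_degFil_of_dvd π h) hy

theorem psi_single_mem_degFil {d : ℚ} {α : Expo p n} (hα : d ≤ Expo.deg α) (a : WittVector p B) :
    psi π (Finsupp.single α a) ∈ degFil π d := by
  classical
  refine ⟨Finsupp.single α a, fun β hβ => ?_, by simp⟩
  rw [Finsupp.single_apply, if_neg]
  rintro rfl
  exact absurd hα (not_le.2 hβ)

theorem degFil_mono {d e : ℚ} (h : d ≤ e) : degFil π e ≤ degFil π d := by
  rintro x ⟨z, hz, hx⟩
  exact ⟨z, fun α hα => hz α (hα.trans_le h), hx⟩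

theorem natCast_mul_mem_degFil {d : ℚ} {x : AcrisHull p C} (k : ℕ) (hx : x ∈ degFil π d) :
    (k : AcrisHull p C) * x ∈ degFil π d := by
  rw [← nsmul_eq_mul]
  exact nsmul_mem hx k

theorem mul_mem_degFil {d e : ℚ} {x y : AcrisHull p C} (hx : x ∈ degFil π d)
    (hy : y ∈ degFil π e) : x * y ∈ degFil π (d + e) := by
  obtain ⟨z, hz, u, hu⟩ := hx
  obtain ⟨w, hw, v, hv⟩ := hy
  refine mem_degFil_of_dvd_sub π (y := psi π z * psi π w) ?_ ?_
  · rw [sub_eq_iff_eq_add] at hu hv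
    rw [hu, hv]
    exact ⟨u * (p * v + psi π w) + psi π z * v, by ring⟩
  · rw [← Finsupp.sum_single z, ← Finsupp.sum_single w, Finsupp.sum, Finsupp.sum, map_sum, map_sum,
      Finset.sum_mul_sum]
    refine sum_mem fun α hα => sum_mem fun β hβ => ?_
    have h1 : d ≤ Expo.deg α := not_lt.1 fun h => Finsupp.mem_support_iff.1 hα (hz α h)
    have h2 : e ≤ Expo.deg β := not_lt.1 fun h => Finsupp.mem_support_iff.1 hβ (hw β h)
    obtain ⟨k, hk⟩ := basisElt_mul π α β
    rw [psi_single, psi_single, mul_mul_mul_comm, hk, mul_left_comm, ← map_mul, ← map_mul,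
      ← psi_single]
    refine natCast_mul_mem_degFil π k (psi_single_mem_degFil π ?_ _)
    rw [Expo.deg_add]
    exact add_le_add h1 h2

theorem one_mem_degFil : (1 : AcrisHull p C) ∈ degFil π 0 := by
  have h := psi_single_mem_degFil π (Expo.deg_nonneg 0) 1
  rwa [psi_single, map_one, map_one, one_mul, basisElt_zero] at h

theorem of_iotaW_mul_mono_mem (a : WittVector p B) {d : ℚ} {α : Expo p n} (hα : d ≤ Expo.deg α) :
    of p (AcrisIdeal p C) (iotaW π a * mono π α) ∈ degFil π d := by
  rw [map_mul, of_mono, mul_left_comm, ← psi_single]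
  exact natCast_mul_mem_degFil π _ (psi_single_mem_degFil π hα a)

theorem of_mem_degFil (x : WittVector p (Perfection C p)) :
    of p (AcrisIdeal p C) x ∈ degFil π 0 := by
  obtain ⟨r, hr⟩ := exists_coeff_sub_lam_eq_zero π hgp.surjective (x.coeff 0) 1
  obtain ⟨t, z, hx⟩ := exists_witt_decomposition π x r hr
  rw [hx, map_add, map_add, map_sum, map_mul, map_natCast, map_pow]
  refine add_mem (add_mem (sum_mem fun α _ => ?_) (mem_degFil_of_dvd π (p_dvd_of_pow t)))
    (mem_degFil_of_dvd π (dvd_mul_right _ _))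
  exact of_iotaW_mul_mono_mem π _ (Expo.deg_nonneg α)

/-- All divided powers of `y` satisfy the expected lower bound for the degree. -/
def DegGood (d : ℚ) (y : AcrisIdeal p C) : Prop :=
  ∀ m : ℕ, gamma p (AcrisIdeal p C) m y ∈ degFil π (m * d)

variable {π}

theorem DegGood.add {d : ℚ} {y y' : AcrisIdeal p C} (h : DegGood π d y) (h' : DegGood π d y') :
    DegGood π d (y + y') := fun m => by
  rw [gamma_add]
  refine sum_mem fun k hk => ?_
  have hk' : k.1 + k.2 = m := Finset.HasAntidiagonal.mem_antidiagonal.1 hk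
  have := mul_mem_degFil π (h k.1) (h' k.2)
  rwa [← add_mul, ← Nat.cast_add, hk'] at this

theorem DegGood.of_dvd {d : ℚ} {y : AcrisIdeal p C}
    (h : ∀ m ≠ 0, (p : AcrisHull p C) ∣ gamma p (AcrisIdeal p C) m y) : DegGood π d y := fun m => by
  by_cases hm : m = 0
  · subst hm
    rw [gamma_zero, Nat.cast_zero, zero_mul]
    exact one_mem_degFil π
  · exact mem_degFil_of_dvd π (h m hm)

theorem DegGood.smul {d : ℚ} {y : AcrisIdeal p C} (h : DegGood π d y)
    (a : WittVector p (Perfection C p)) : DegGood π d (a • y) := fun m => by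
  rw [gamma_smul, ← map_pow]
  have := mul_mem_degFil π (of_mem_degFil π (a ^ m)) (h m)
  rwa [zero_add] at this

theorem DegGood.mono {d e : ℚ} (hde : d ≤ e) {y : AcrisIdeal p C} (h : DegGood π e y) :
    DegGood π d y := fun m =>
  degFil_mono π (mul_le_mul_of_nonneg_left hde (Nat.cast_nonneg m)) (h m)

theorem DegGood.sum {d : ℚ} {ι : Type*} (s : Finset ι) (f : ι → AcrisIdeal p C)
    (h : ∀ i ∈ s, DegGood π d (f i)) : DegGood π d (∑ i ∈ s, f i) := by
  classical
  induction s using Finset.induction_on with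
  | empty =>
    refine DegGood.of_dvd fun m hm => ?_
    have : (∑ i ∈ (∅ : Finset ι), f i) = (0 : WittVector p (Perfection C p)) • ∑ i ∈ ∅, f i := by simp
    rw [this, gamma_smul, map_zero, zero_pow hm, zero_mul]
    exact dvd_zero _
  | insert a s ha ih =>
    rw [Finset.sum_insert ha]
    exact (h a (Finset.mem_insert_self _ _)).add (ih fun i hi => h i (Finset.mem_insert_of_mem hi))

variable (π)

/-- A big monomial factors as `x^α = x^β x_i`, so `γ_m(x^α) = x^{mβ} γ_m(x_i)`. This is an integer
multiple of the basis element of exponent `mα`. -/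
theorem degGood_mono {α : Expo p n} (hα : Expo.Big α) :
    DegGood π (Expo.deg α) ⟨mono π α, mono_mem π hα⟩ := fun m => by
  classical
  obtain ⟨i, hi⟩ := hα
  let β : Expo p n := Function.update α i
      ⟨α i - (1 : ℕ), Expo.sub_natCast_mem (α i).2 (by simpa using hi)⟩
  have hβ : α = β + unitExpo p i := by
    funext j
    refine Subtype.ext ?_
    by_cases hj : j = i
    · subst hj
      simp [β, unitExpo]
    · simp [β, unitExpo, hj]
  have e : (⟨mono π α, mono_mem π ⟨i, hi⟩⟩ : AcrisIdeal p C) = mono π β • xker π i := by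
    refine Subtype.ext ?_
    change mono π α = mono π β * mono π (unitExpo p i)
    rw [← mono_add, ← hβ]
  have hγ : gamma p (AcrisIdeal p C) m (xker π i) =
      ∏ j, gamma p (AcrisIdeal p C) ((Pi.single i m : Fin n → ℕ) j) (xker π j) := by
    rw [Finset.prod_eq_single i (fun j _ hj => by rw [Pi.single_eq_of_ne hj, gamma_zero])
      (fun h => absurd (Finset.mem_univ i) h), Pi.single_eq_same]
  rw [e, gamma_smul, ← map_pow, ← mono_nsmul, hγ, of_mono_mul_prod]
  have hdeg : (m : ℚ) * Expo.deg α = Expo.deg (m • β + Expo.ofNat (Pi.single i m)) := by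
    rw [← Expo.deg_nsmul, hβ, nsmul_add]
    congr 2
    rw [ofNat_eq_sum, Finset.sum_eq_single i
      (fun j _ hj => by rw [Pi.single_eq_of_ne hj, zero_smul])
      (fun h => absurd (Finset.mem_univ i) h), Pi.single_eq_same]
  refine natCast_mul_mem_degFil π _ ?_
  have := psi_single_mem_degFil π hdeg.le 1
  rwa [psi_single, map_one, map_one, one_mul] at this

/-- Up to sign-free corrections `t^p` and `p z`, whose divided powers of positive index are
divisible by `p`, the element `y` is a combination of big monomials of degree at least `d`. -/
theorem degGood_of_representative {d : ℚ} (y : AcrisIdeal p C) (r : PerfPolynomial p B n)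
    (hr : Perfection.coeff C p 1 ((y : WittVector p (Perfection C p)).coeff 0 - lam π r) = 0)
    (hbig : ∀ α ∈ r.coeff.support, Expo.Big α ∧ d ≤ Expo.deg α) : DegGood π d y := by
  obtain ⟨t, z, hx⟩ := exists_witt_decomposition π _ r hr
  have e : y = ∑ α ∈ r.coeff.support.attach,
      iotaW π (WittVector.teichmuller p (r.coeff α)) •
        (⟨mono π α, mono_mem π (hbig α α.2).1⟩ : AcrisIdeal p C) +
      (t : WittVector p (Perfection C p)) ^ (p - 1) • t + z • ⟨p, p_mem_acrisIdeal⟩ := by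
    refine Subtype.ext ?_
    rw [hx]
    simp only [Submodule.coe_add, Submodule.coe_smul, smul_eq_mul, AddSubmonoidClass.coe_finsetSum]
    rw [← pow_succ, Nat.sub_add_cancel hp.out.one_le, mul_comm z,
      Finset.sum_attach r.coeff.support fun α =>
        iotaW π (WittVector.teichmuller p (r.coeff α)) * mono π α]
  rw [e]
  refine ((DegGood.sum _ _ fun α _ => ?_).add (DegGood.of_dvd fun m hm => ?_)).add
    (DegGood.of_dvd fun m hm => ?_)
  · exact ((degGood_mono π (hbig α α.2).1).mono (hbig α α.2).2).smul _
  · refine dvd_gamma_pow_p hm _ t ?_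
    rw [Submodule.coe_smul, smul_eq_mul, ← pow_succ, Nat.sub_add_cancel hp.out.one_le]
  · exact dvd_gamma_p_smul hm _ (by
      rw [Submodule.coe_smul, smul_eq_mul]
      exact dvd_mul_left _ _) p_mem_acrisIdeal

/-- Since degrees are nonnegative, this says that the `x^α / ⌊α⌋!` span modulo `p`. The filtration
step of degree 0 is a subring, so the generators of the hull suffice. -/
theorem mem_degFil_zero (x : AcrisHull p C) : x ∈ degFil π 0 := by
  let S : Subring (AcrisHull p C) :=
    { degFil π 0 with
      one_mem' := one_mem_degFil π
      mul_mem' := fun hx hy => by simpa using mul_mem_degFil π hx hy }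
  refine mem_of_generators S (of_mem_degFil π) (fun m y => ?_) x
  obtain ⟨r, hr, hbig⟩ := exists_small_representative π hgp.surjective hgp.ker_eq _ y.2
  have := degGood_of_representative π y r hr fun α hα =>
    ⟨(hbig α hα).1, Expo.deg_nonneg α⟩
  have := this m
  rwa [mul_zero] at this

theorem exists_psi_p_dvd_sub (x : AcrisHull p C) : ∃ z, (p : AcrisHull p C) ∣ x - psi π z :=
  let ⟨z, _, h⟩ := mem_degFil_zero π x
  ⟨z, h⟩

theorem psi_natCast_mul (k : ℕ) (z : Expo p n →₀ WittVector p B) :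
    psi π (k • z) = (k : AcrisHull p C) * psi π z := by
  rw [map_nsmul, nsmul_eq_mul]

theorem exists_psi_p_pow_dvd_sub (x : AcrisHull p C) (N : ℕ) :
    ∃ z, (p : AcrisHull p C) ^ N ∣ x - psi π z := by
  induction N with
  | zero => exact ⟨0, by simp⟩
  | succ N ih =>
    obtain ⟨z, u, hu⟩ := ih
    obtain ⟨w, v, hv⟩ := exists_psi_p_dvd_sub π u
    refine ⟨z + (p ^ N) • w, v, ?_⟩
    rw [map_add, psi_natCast_mul, ← sub_sub, hu, pow_succ, mul_assoc, ← hv]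
    push_cast
    ring

end Span

/-! ### Torsion-free models -/

theorem AddMonoidAlgebra.coeff_natCast_mul {K G : Type*} [CommSemiring K] [AddCommMonoid G] (k : ℕ)
    (f : AddMonoidAlgebra K G) (α : G) :
    ((k : AddMonoidAlgebra K G) * f).coeff α = k * f.coeff α := by
  rw [← nsmul_eq_mul, AddMonoidAlgebra.coeff_smul, Finsupp.smul_apply, nsmul_eq_mul]

theorem AdicCompletion.p_dvd_of_p_dvd_algebraMap {S : Type*} [CommRing S] {p : ℕ} {x : S}
    (h : (p : AdicCompletion (Ideal.span {(p : S)}) S) ∣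
      algebraMap S (AdicCompletion (Ideal.span {(p : S)}) S) x) : (p : S) ∣ x := by
  obtain ⟨y, hy⟩ := h
  have h1 := AdicCompletion.evalₐ_p_pow_mul 1 y
  have h2 : (p : AdicCompletion (Ideal.span {(p : S)}) S) ^ 1 * y = algebraMap _ _ x := by
    rw [pow_one, hy]
  rw [h2, AlgHom.commutes, Ideal.Quotient.algebraMap_eq, Ideal.Quotient.eq_zero_iff_mem, pow_one,
    Ideal.mem_span_singleton] at h1
  exact h1

/-! ### Factorials and divided powers in `p`-adically complete rings -/

section Complete

variable {p : ℕ} [hp : Fact p.Prime] {S : Type*} [CommRing S]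

theorem IsAdicComplete.isUnit_natCast [IsAdicComplete (Ideal.span {(p : S)}) S] {b : ℕ}
    (hb : ¬ p ∣ b) : IsUnit (b : S) := by
  have hc : Nat.Coprime b p := ((Nat.Prime.coprime_iff_not_dvd hp.out).2 hb).symm
  obtain ⟨s, t, hst⟩ := hc.cast (R := S)
  have hj := IsAdicComplete.le_jacobson_bot (Ideal.span {(p : S)}) (Ideal.mem_span_singleton_self _)
  have := Ideal.mem_jacobson_bot.1 hj (-t)
  refine isUnit_of_mul_isUnit_right (x := s) ?_
  have e : s * (b : S) = p * -t + 1 := by rw [← hst]; ring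
  rw [e]
  exact this

theorem IsAdicComplete.factorial_dvd_p_pow [IsAdicComplete (Ideal.span {(p : S)}) S] (m : ℕ) :
    (m ! : S) ∣ (p : S) ^ m := by
  obtain ⟨e, b, hb, hf⟩ := Nat.exists_eq_pow_mul_and_not_dvd (Nat.factorial_ne_zero m) p hp.out.ne_one
  have he : e ≤ m := by
    by_cases hm : m = 0
    · subst hm
      rcases Nat.eq_zero_or_pos e with h | h
      · exact h.le
      · have h1 : p ∣ 0 ! := by
          rw [hf]
          exact (dvd_pow_self p h.ne').mul_right b
        exact absurd (Nat.dvd_one.1 h1) hp.out.ne_one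
    · have h1 := padicValNat_factorial_lt_of_ne_zero p hm
      have h2 : padicValNat p (m !) = e := by
        rw [hf, padicValNat.mul (pow_ne_zero _ hp.out.ne_zero) (by rintro rfl; simp at hb),
          padicValNat.prime_pow, padicValNat.eq_zero_of_not_dvd hb, add_zero]
      omega
  rw [hf, Nat.cast_mul, (IsAdicComplete.isUnit_natCast (p := p) hb).mul_right_dvd, Nat.cast_pow]
  exact pow_dvd_pow _ he

variable (S) in
/-- The ideal of elements having all divided powers, in a torsion-free ring. -/
def dpIdeal : Ideal S where
  carrier := {z | ∀ m : ℕ, (m ! : S) ∣ z ^ m}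
  zero_mem' := fun m => by
    rcases Nat.eq_zero_or_pos m with h | h
    · simp [h]
    · rw [zero_pow h.ne']
      exact dvd_zero _
  add_mem' := by
    intro x y hx hy m
    rw [(Commute.all x y).add_pow']
    refine Finset.dvd_sum fun k hk => ?_
    obtain ⟨a, ha⟩ := hx k.1
    obtain ⟨b, hb⟩ := hy k.2
    have hk' : k.1 + k.2 = m := Finset.HasAntidiagonal.mem_antidiagonal.1 hk
    rw [ha, hb, ← hk', nsmul_eq_mul]
    refine ⟨a * b, ?_⟩
    rw [← Nat.add_choose_mul_factorial_mul_factorial, ← Nat.choose_symm_add]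
    push_cast
    ring
  smul_mem' := by
    intro c x hx m
    rw [smul_eq_mul, mul_pow]
    exact (hx m).mul_left _

theorem dvd_pow_of_mem_dpIdeal {z : S} (hz : z ∈ dpIdeal S) : (p : S) ∣ z ^ p :=
  (Nat.cast_dvd_cast (Nat.dvd_factorial hp.out.pos le_rfl)).trans (hz p)

end Complete

/-- A `p`-torsion-free ring containing divided monomials `x^α / ⌊α⌋!`, linearly independent over
`W(B)` modulo `p`. -/
structure PDModel (p : ℕ) [Fact p.Prime] (B : Type u) [CommRing B] (n : ℕ) (S : Type u)
    [CommRing S] where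
  /-- The constants. -/
  const : WittVector p B →+* S
  /-- The monomials. -/
  X : Multiplicative (Expo p n) →* S
  /-- The divided monomials. -/
  term : Expo p n → S
  fact_mul_term : ∀ α, (Expo.fact α : S) * term α = X (Multiplicative.ofAdd α)
  eq_zero_of_p_mul : ∀ s : S, (p : S) * s = 0 → s = 0
  indep : ∀ z : Expo p n →₀ WittVector p B, (p : S) ∣ z.sum (fun α a => const a * term α) →
    ∀ α, (p : WittVector p B) ∣ z α

section Fractions

variable (p : ℕ) [hp : Fact p.Prime] (B : Type u) [CommRing B] (n : ℕ)
  (K : Type u) [CommRing K] [Algebra (WittVector p B) K]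

/-- The ring of combinations of the `x^α / ⌊α⌋!` with coefficients in `W(B)`, inside the ring of
combinations of the `x^α` with coefficients in a larger ring. -/
def DividedMonomials : Subring (AddMonoidAlgebra K (Expo p n)) where
  carrier := {f | ∀ α, ∃ a, algebraMap (WittVector p B) K a = Expo.fact α * f.coeff α}
  zero_mem' := fun α => ⟨0, by simp⟩
  add_mem' := by
    intro f g hf hg α
    obtain ⟨a, ha⟩ := hf α
    obtain ⟨b, hb⟩ := hg α
    exact ⟨a + b, by rw [map_add, ha, hb, AddMonoidAlgebra.coeff_add, Finsupp.add_apply, mul_add]⟩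
  neg_mem' := by
    intro f hf α
    obtain ⟨a, ha⟩ := hf α
    exact ⟨-a, by rw [map_neg, ha, AddMonoidAlgebra.coeff_neg, Finsupp.neg_apply, mul_neg]⟩
  one_mem' := by
    classical
    intro α
    rw [AddMonoidAlgebra.one_def, AddMonoidAlgebra.coeff_single, Finsupp.single_apply]
    split_ifs
    · exact ⟨Expo.fact α, by simp⟩
    · exact ⟨0, by simp⟩
  mul_mem' := by
    classical
    intro f g hf hg γ
    rw [AddMonoidAlgebra.coeff_mul, Finsupp.sum, Finset.mul_sum]
    choose a ha using hf
    choose b hb using hg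
    have key : ∀ α β, ∃ c, algebraMap (WittVector p B) K c =
        Expo.fact γ * (if α + β = γ then f.coeff α * g.coeff β else 0) := by
      intro α β
      split_ifs with h
      · obtain ⟨k, hk⟩ := Expo.fact_mul_fact_dvd α β
        refine ⟨k * (a α * b β), ?_⟩
        rw [map_mul, map_mul, ha, hb, ← h, hk, map_natCast]
        push_cast
        ring
      · exact ⟨0, by simp⟩
    choose c hc using key
    refine ⟨∑ α ∈ f.coeff.support, ∑ β ∈ g.coeff.support, c α β, ?_⟩
    simp_rw [map_sum, hc, Finsupp.sum, Finset.mul_sum]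

variable {p B n K}

theorem DividedMonomials.single_mem {α : Expo p n} {x : K}
    (h : ∃ a, algebraMap (WittVector p B) K a = Expo.fact α * x) :
    AddMonoidAlgebra.single α x ∈ DividedMonomials p B n K := by
  classical
  intro β
  rw [AddMonoidAlgebra.coeff_single, Finsupp.single_apply]
  split_ifs with hβ
  · rw [← hβ]
    exact h
  · exact ⟨0, by simp⟩

theorem DividedMonomials.coeff_natCast_mul (k : ℕ) (x : DividedMonomials p B n K) (α : Expo p n) :
    (((k : DividedMonomials p B n K) * x : DividedMonomials p B n K) :
      AddMonoidAlgebra K (Expo p n)).coeff α =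
      k * (x : AddMonoidAlgebra K (Expo p n)).coeff α := by
  rw [Subring.coe_mul, SubringClass.coe_natCast, AddMonoidAlgebra.coeff_natCast_mul]

variable (p B n K)

/-- The monomial `x^α` in the ring of divided monomials. -/
def DividedMonomials.X : Multiplicative (Expo p n) →* DividedMonomials p B n K where
  toFun α := ⟨AddMonoidAlgebra.single α.toAdd 1, single_mem ⟨Expo.fact α.toAdd, by simp⟩⟩
  map_one' := rfl
  map_mul' α β := Subtype.ext (by simp [AddMonoidAlgebra.single_mul_single])

/-- The constants in the ring of divided monomials. -/
def DividedMonomials.const : WittVector p B →+* DividedMonomials p B n K where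
  toFun a := ⟨AddMonoidAlgebra.single 0 (algebraMap _ _ a),
    single_mem ⟨Expo.fact (0 : Expo p n) * a, by simp⟩⟩
  map_one' := Subtype.ext (by simp [AddMonoidAlgebra.one_def])
  map_mul' a b := Subtype.ext (by simp [AddMonoidAlgebra.single_mul_single])
  map_zero' := Subtype.ext (by simp)
  map_add' a b := Subtype.ext (by simp)

/-- The model attached to a ring extension of `W(B)` in which the nonzero natural numbers are
invertible. -/
def PDModel.ofFractions (hinj : Function.Injective (algebraMap (WittVector p B) K))
    (hunit : ∀ k : ℕ, k ≠ 0 → IsUnit (k : K)) : PDModel p B n (DividedMonomials p B n K) where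
  const := DividedMonomials.const p B n K
  X := DividedMonomials.X p B n K
  term α := ⟨AddMonoidAlgebra.single α ((hunit _ (Expo.fact_ne_zero α)).unit⁻¹ : Kˣ),
    DividedMonomials.single_mem ⟨1, by rw [map_one, IsUnit.mul_val_inv]⟩⟩
  fact_mul_term α := by
    classical
    refine Subtype.ext (AddMonoidAlgebra.ext (Finsupp.ext fun β => ?_))
    rw [DividedMonomials.coeff_natCast_mul]
    change _ * (AddMonoidAlgebra.single α _).coeff β = (AddMonoidAlgebra.single α 1).coeff β
    rw [AddMonoidAlgebra.coeff_single, AddMonoidAlgebra.coeff_single, Finsupp.single_apply,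
      Finsupp.single_apply]
    split_ifs
    · rw [IsUnit.mul_val_inv]
    · rw [mul_zero]
  eq_zero_of_p_mul s hs := by
    refine Subtype.ext (AddMonoidAlgebra.ext (Finsupp.ext fun α => ?_))
    have h1 := DividedMonomials.coeff_natCast_mul p s α
    rw [hs] at h1
    exact (hunit p hp.out.ne_zero).mul_right_eq_zero.1 h1.symm
  indep z hz α := by
    classical
    -- Multiplying the coefficient at `α` by `⌊α⌋!` recovers `z α`. Applied to `p y` with `y` a
    -- divided-monomial combination, it shows `z α = p a` with `a` in `W(B)`.
    have key : ∀ z : Expo p n →₀ WittVector p B, (Expo.fact α : K) *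
        ((z.sum fun α a => DividedMonomials.const p B n K a *
          (⟨AddMonoidAlgebra.single α ((hunit _ (Expo.fact_ne_zero α)).unit⁻¹ : Kˣ),
            DividedMonomials.single_mem ⟨1, by rw [map_one, IsUnit.mul_val_inv]⟩⟩ :
              DividedMonomials p B n K) :
          DividedMonomials p B n K) : AddMonoidAlgebra K (Expo p n)).coeff α =
        algebraMap (WittVector p B) K (z α) := by
      intro z
      induction z using Finsupp.induction_linear with
      | zero => simp
      | add f g hf hg =>
        rw [Finsupp.sum_add_index' (fun _ => by rw [map_zero, zero_mul])
          (fun _ _ _ => by rw [map_add, add_mul]), Subring.coe_add, AddMonoidAlgebra.coeff_add,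
          Finsupp.add_apply, mul_add, hf, hg, Finsupp.add_apply, map_add]
      | single β a =>
        rw [Finsupp.sum_single_index (by rw [map_zero, zero_mul]), Subring.coe_mul]
        change _ * (AddMonoidAlgebra.single 0 _ * AddMonoidAlgebra.single β _).coeff α = _
        rw [AddMonoidAlgebra.single_mul_single, zero_add, AddMonoidAlgebra.coeff_single,
          Finsupp.single_apply, Finsupp.single_apply]
        split_ifs with h
        · rw [← h, mul_left_comm, IsUnit.mul_val_inv, mul_one]
        · rw [mul_zero, map_zero]
    obtain ⟨y, hy⟩ := hz
    obtain ⟨a, ha⟩ := y.2 α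
    refine ⟨a, hinj ?_⟩
    rw [← key, hy, map_mul, ha, map_natCast, DividedMonomials.coeff_natCast_mul, mul_left_comm]

end Fractions

section Completion

variable {p : ℕ} [hp : Fact p.Prime] {B : Type u} [CommRing B] {n : ℕ} {S : Type u} [CommRing S]

/-- The `p`-adic completion of a model. -/
def PDModel.completion (M : PDModel p B n S) :
    PDModel p B n (AdicCompletion (Ideal.span {(p : S)}) S) where
  const := (algebraMap _ _).comp M.const
  X := (algebraMap S (AdicCompletion (Ideal.span {(p : S)}) S) : S →* _).comp M.X
  term α := algebraMap _ _ (M.term α)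
  fact_mul_term α := by
    change _ = algebraMap _ _ (M.X _)
    rw [← M.fact_mul_term, map_mul, map_natCast]
  eq_zero_of_p_mul s hs := by
    refine AdicCompletion.eq_zero_of_p_mul (fun N d hd => ?_) hs
    obtain ⟨e, he⟩ := hd
    refine ⟨e, sub_eq_zero.1 (M.eq_zero_of_p_mul _ ?_)⟩
    rw [mul_sub, he, pow_succ']
    ring
  indep z hz := by
    refine M.indep z (AdicCompletion.p_dvd_of_p_dvd_algebraMap ?_)
    rw [Finsupp.sum, map_sum]
    simp_rw [map_mul]
    exact hz

variable [CharP B p] [PerfectRing B p]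

variable (p B n) in
-- `W(B)` need not be a domain, but nonzero integers are nonzerodivisors in it, hence units in its
-- total fraction ring. Completing prepares the target for Fontaine's `θ`.
theorem PDModel.exists_complete : ∃ (T : Type u) (_ : CommRing T)
    (_ : IsAdicComplete (Ideal.span {(p : T)}) T), Nonempty (PDModel p B n T) := by
  refine ⟨_, _, AdicCompletion.isAdicComplete_span_p,
    ⟨(PDModel.ofFractions p B n (FractionRing (WittVector p B)) (IsFractionRing.injective _ _)
      fun k hk => ?_).completion⟩⟩
  have h : (k : WittVector p B) ∈ nonZeroDivisors (WittVector p B) :=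
    mem_nonZeroDivisors_iff_right.2 fun x hx =>
      WittVector.eq_zero_of_natCast_mul k hk x (by rw [mul_comm]; exact hx)
  have := IsLocalization.map_units (FractionRing (WittVector p B)) ⟨_, h⟩
  rwa [map_natCast] at this

theorem Finsupp.exists_p_smul {z : Expo p n →₀ WittVector p B}
    (h : ∀ α, (p : WittVector p B) ∣ z α) : ∃ w : Expo p n →₀ WittVector p B, z = p • w := by
  choose c hc using h
  refine ⟨Finsupp.onFinset z.support c fun α hα => Finsupp.mem_support_iff.2 fun h0 => hα ?_, ?_⟩
  · exact WittVector.eq_zero_of_natCast_mul p hp.out.ne_zero _ (by rw [← hc, h0])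
  · ext1 α
    rw [Finsupp.smul_apply, Finsupp.onFinset_apply, nsmul_eq_mul, hc]

theorem PDModel.not_isUnit_p (M : PDModel p B n S) : ¬ IsUnit (p : S) := fun h => by
  have : Nontrivial B := CharP.nontrivial_of_char_ne_one hp.out.ne_one
  have h2 := M.indep (Finsupp.single 0 1) h.dvd 0
  rw [WittVector.p_dvd_iff, Finsupp.single_eq_same, WittVector.one_coeff_zero] at h2
  exact one_ne_zero h2

end Completion

/-! ### The comparison with a torsion-free model -/

namespace PDModel

section Reduction

variable {p : ℕ} [hp : Fact p.Prime] {B : Type u} [CommRing B] {n : ℕ} {T : Type u} [CommRing T]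

variable (p T) in
/-- The reduction map modulo `p`. -/
def red : T →+* ModP T p := Ideal.Quotient.mk _

theorem red_eq_iff {p : ℕ} {T : Type u} [CommRing T] (x y : T) : red p T x = red p T y ↔ (p : T) ∣ x - y := by
  rw [red, Ideal.Quotient.eq, Ideal.mem_span_singleton]

variable (M : PDModel p B n T)

theorem X_mem_dpIdeal (i : Fin n) :
    M.X (Multiplicative.ofAdd (unitExpo p i)) ∈ dpIdeal T := by
  classical
  intro m
  have h : Expo.fact (m • unitExpo p i) = m ! := by
    rw [Expo.fact, Finset.prod_eq_single i]
    · simp [Expo.fl, unitExpo]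
    · intro j _ hj
      simp [Expo.fl, unitExpo, hj]
    · exact fun h => absurd (Finset.mem_univ i) h
  rw [← map_pow, ← ofAdd_nsmul, ← h, ← M.fact_mul_term]
  exact dvd_mul_right _ _

theorem eq_zero_of_natCast_mul (M : PDModel p B n T) [IsAdicComplete (Ideal.span {(p : T)}) T] (k : ℕ) (hk : k ≠ 0) (s : T)
    (hs : (k : T) * s = 0) : s = 0 :=
  IsHausdorff.eq_zero_of_natCast_mul p M.eq_zero_of_p_mul k hk s hs

variable [CharP B p] [PerfectRing B p]

theorem red_const_eq {a b : WittVector p B} (h : a.coeff 0 = b.coeff 0) :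
    red p T (M.const a) = red p T (M.const b) := by
  rw [red_eq_iff, ← map_sub]
  have := map_dvd M.const ((WittVector.p_dvd_sub_iff a b).2 h)
  rwa [map_natCast] at this

/-- The homomorphism from `B` to the reduction of the model. -/
def ofB : B →+* ModP T p where
  toFun b := red p T (M.const (WittVector.teichmuller p b))
  map_one' := by rw [map_one, map_one, map_one]
  map_mul' a b := by rw [map_mul, map_mul, map_mul]
  map_zero' := by rw [WittVector.teichmuller_zero, map_zero, map_zero]
  -- Teichmüller representatives are additive only modulo `p`, which is enough in `T / p`.
  map_add' a b := by
    rw [← map_add (red p T), ← map_add M.const]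
    refine M.red_const_eq ?_
    have h : ∀ x y : WittVector p B, (x + y).coeff 0 = x.coeff 0 + y.coeff 0 :=
      fun x y => map_add WittVector.constantCoeff x y
    rw [h]
    simp only [WittVector.teichmuller_coeff_zero]

theorem ofB_coeff_zero (a : WittVector p B) : M.ofB (a.coeff 0) = red p T (M.const a) :=
  M.red_const_eq (WittVector.teichmuller_coeff_zero p _)

/-- The homomorphism from the perfect polynomial ring to the reduction of the model. -/
def tau : PerfPolynomial p B n →+* ModP T p :=
  AddMonoidAlgebra.liftNCRingHom M.ofB
    ((red p T : T →* ModP T p).comp M.X) fun _ _ => Commute.all _ _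

theorem tau_single (α : Expo p n) (b : B) :
    M.tau (AddMonoidAlgebra.single α b) = M.ofB b * red p T (M.X (Multiplicative.ofAdd α)) :=
  AddMonoidAlgebra.liftNCRingHom_single _ _ _ _ _

theorem tau_single_one (α : Expo p n) :
    M.tau (AddMonoidAlgebra.single α (1 : B)) = red p T (M.X (Multiplicative.ofAdd α)) := by
  rw [tau_single, map_one, one_mul]

theorem exists_mem_dpIdeal_red_eq {s : PerfPolynomial p B n}
    (hs : s ∈ Ideal.span (Set.range (perfVar p B n))) :
    ∃ w ∈ dpIdeal T, red p T w = M.tau s := by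
  have hle : Ideal.span (Set.range (perfVar p B n)) ≤ ((dpIdeal T).map (red p T)).comap M.tau := by
    rw [Ideal.span_le]
    rintro _ ⟨i, rfl⟩
    change M.tau (AddMonoidAlgebra.single (unitExpo p i) 1) ∈ (dpIdeal T).map (red p T)
    rw [tau_single_one]
    exact Ideal.mem_map_of_mem _ (M.X_mem_dpIdeal i)
  exact (Ideal.mem_map_iff_of_surjective (red p T) Ideal.Quotient.mk_surjective).1 (hle hs)

end Reduction

section Theta

variable {p : ℕ} [hp : Fact p.Prime] {B : Type u} [CommRing B] {n : ℕ} {T : Type u} [CommRing T]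
  (M : PDModel p B n T) [CharP B p] [PerfectRing B p] {C : Type u} [CommRing C]
  (π : PerfPolynomial p B n →+* C) [hgp : IsGoodPresentation π]

/-- The homomorphism `C → T / p` through which the Frobenius of `T / p` factors. -/
def sigma : C →+* ModP T p :=
  RingHom.liftOfSurjective π hgp.surjective
    ⟨M.tau.comp (frobenius (PerfPolynomial p B n) p), fun r hr => by
      rw [hgp.ker_eq] at hr
      -- An element of `(x_1, …, x_n)` has an image that lifts to some `w` with divided powers; then
      -- `p! ∣ w^p`, so Frobenius kills it modulo `p`.
      obtain ⟨w, hw, hwr⟩ := M.exists_mem_dpIdeal_red_eq hr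
      rw [RingHom.mem_ker, RingHom.comp_apply, frobenius_def, map_pow, ← hwr, ← map_pow,
        ← map_zero (red p T), red_eq_iff, sub_zero]
      exact dvd_pow_of_mem_dpIdeal hw⟩

theorem sigma_apply (r : PerfPolynomial p B n) : M.sigma π (π r) = M.tau (r ^ p) :=
  RingHom.liftOfSurjective_comp_apply _ _ _ _

variable [CharP C p]

/-- The homomorphism `C^♭ → T / p`. -/
def ofTilt : Perfection C p →+* ModP T p := (M.sigma π).comp (Perfection.coeff C p 1)

/-- The Frobenius built into `sigma` is undone by reading the tilt at index 1, which amounts to a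
`p`-th root. -/
theorem ofTilt_lam (r : PerfPolynomial p B n) : M.ofTilt π (lam π r) = M.tau r := by
  obtain ⟨s, rfl⟩ := surjective_frobenius (PerfPolynomial p B n) p r
  have h := coeff_lam_pow π s 1
  rw [pow_one] at h
  rw [ofTilt, RingHom.comp_apply, frobenius_def, h, sigma_apply]

variable [hc : IsAdicComplete (Ideal.span {(p : T)}) T]

/-- As `C^♭` is perfect, the map to `T / p` lifts to the perfection of `T / p`. Applying `W` and
then Fontaine's `θ` for the complete ring `T` gives the lift. -/
theorem exists_theta : ∃ θ : WittVector p (Perfection C p) →+* T,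
    ∀ x, red p T (θ x) = M.ofTilt π (x.coeff 0) := by
  have : Fact (¬ IsUnit (p : T)) := ⟨M.not_isUnit_p⟩
  refine ⟨(WittVector.fontaineTheta T p).comp
    (WittVector.map (Perfection.lift p (Perfection C p) (ModP T p) (M.ofTilt π))), fun x => ?_⟩
  have h := WittVector.mk_fontaineTheta (R := T) (p := p)
    (WittVector.map (Perfection.lift p (Perfection C p) (ModP T p) (M.ofTilt π)) x)
  rw [WittVector.map_coeff] at h
  exact h

/-- The homomorphism `W(C^♭) → T` lifting `C^♭ → T / p`. -/
def theta : WittVector p (Perfection C p) →+* T := (M.exists_theta π).choose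

theorem red_theta (x : WittVector p (Perfection C p)) :
    red p T (M.theta π x) = M.ofTilt π (x.coeff 0) := (M.exists_theta π).choose_spec x

/-- Both sides are compatible with `p^N`-th roots of the monomial. A congruence modulo `p` between
these roots becomes one modulo `p^(N+1)` after raising to the power `p^N`. -/
theorem theta_mono (α : Expo p n) : M.theta π (mono π α) = M.X (Multiplicative.ofAdd α) := by
  refine sub_eq_zero.1 (IsHausdorff.eq_zero_of_forall_p_pow_dvd (p := p) fun N => ?_)
  have hα : ∀ N : ℕ, p ^ N • Expo.divP^[N] α = α := by
    intro N
    induction N with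
    | zero => simp
    | succ N ih => rw [Function.iterate_succ_apply', pow_succ, mul_smul, Expo.smul_divP, ih]
  have h1 : (p : T) ∣ M.theta π (mono π (Expo.divP^[N] α)) -
      M.X (Multiplicative.ofAdd (Expo.divP^[N] α)) := by
    rw [← red_eq_iff, red_theta, mono_def, WittVector.teichmuller_coeff_zero, ofTilt_lam,
      tau_single_one]
  have h2 := dvd_sub_pow_of_dvd_sub h1 N
  rw [← map_pow, ← mono_nsmul, ← map_pow, ← ofAdd_nsmul, hα] at h2
  exact (pow_dvd_pow _ (Nat.le_succ N)).trans h2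

/-- If `r` lifts the first coefficient, then `r^p` lies in `(x_1, …, x_n)` and `θ(x)` is the sum of
a multiple of `p` and an element with divided powers; both summands lie in `dpIdeal T`. -/
theorem factorial_dvd_theta_pow (x : WittVector p (Perfection C p)) (hx : x ∈ AcrisIdeal p C)
    (m : ℕ) : (m ! : T) ∣ M.theta π x ^ m := by
  suffices h : M.theta π x ∈ dpIdeal T from h m
  obtain ⟨r, hr⟩ := hgp.surjective (Perfection.coeff C p 1 (x.coeff 0))
  have h1 : r ^ p ∈ Ideal.span (Set.range (perfVar p B n)) := by
    rw [← hgp.ker_eq, RingHom.mem_ker, map_pow, hr, Perfection.coeff_pow_p']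
    exact hx
  obtain ⟨w, hw, hwr⟩ := M.exists_mem_dpIdeal_red_eq h1
  have h2 : (p : T) ∣ M.theta π x - w := by
    rw [← red_eq_iff, red_theta, hwr, ← M.sigma_apply π, hr]
    rfl
  obtain ⟨y, hy⟩ := h2
  have h3 : (p : T) ∈ dpIdeal T := IsAdicComplete.factorial_dvd_p_pow
  rw [← sub_add_cancel (M.theta π x) w, hy]
  exact add_mem (Ideal.mul_mem_right _ _ h3) hw

/-- The homomorphism from the divided power hull to the model. -/
def ofHull : AcrisHull p C →+* T :=
  PDHull.lift p (M.theta π) (M.factorial_dvd_theta_pow π) M.eq_zero_of_natCast_mul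

theorem ofHull_of (x : WittVector p (Perfection C p)) :
    M.ofHull π (of p (AcrisIdeal p C) x) = M.theta π x :=
  PDHull.lift_of _ _ _ _ _

theorem ofHull_basisElt (α : Expo p n) : M.ofHull π (basisElt π α) = M.term α := by
  refine PDHull.cancel_natCast M.eq_zero_of_natCast_mul (Expo.fact_ne_zero α) ?_
  rw [M.fact_mul_term, ← theta_mono M π, ← ofHull_of, of_mono, map_mul, map_natCast]

theorem p_dvd_ofHull_psi_sub (z : Expo p n →₀ WittVector p B) :
    (p : T) ∣ M.ofHull π (psi π z) - z.sum fun α a => M.const a * M.term α := by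
  induction z using Finsupp.induction_linear with
  | zero => simp
  | add f g hf hg =>
    rw [map_add, map_add, Finsupp.sum_add_index' (fun _ => by rw [map_zero, zero_mul])
      (fun _ _ _ => by rw [map_add, add_mul]), add_sub_add_comm]
    exact dvd_add hf hg
  | single α a =>
    rw [psi_single, Finsupp.sum_single_index (by rw [map_zero, zero_mul]), map_mul,
      ofHull_basisElt, ofHull_of, ← sub_mul]
    refine Dvd.dvd.mul_right ?_ _
    rw [← red_eq_iff, red_theta, iotaW, WittVector.map_coeff, RingHom.comp_apply, ofTilt_lam,
      ← ofB_coeff_zero]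
    change M.tau (AddMonoidAlgebra.single 0 (a.coeff 0)) = _
    rw [tau_single, ofAdd_zero, map_one, map_one, mul_one]

/-- `θ` on `W(B)` is compared with the constants only modulo `p`. This suffices: independence modulo
`p` extracts one factor `p` from `z`, which cancels in the torsion-free `T`, and the argument
repeats. -/
theorem exists_eq_smul_of_p_pow_dvd (N : ℕ) (z : Expo p n →₀ WittVector p B)
    (h : (p : T) ^ N ∣ M.ofHull π (psi π z)) : ∃ w : Expo p n →₀ WittVector p B, z = p ^ N • w := by
  induction N generalizing z with
  | zero => exact ⟨z, by simp⟩
  | succ N ih =>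
    have h1 := dvd_sub ((dvd_pow_self _ (Nat.succ_ne_zero N)).trans h)
      (M.p_dvd_ofHull_psi_sub π z)
    rw [sub_sub_cancel] at h1
    obtain ⟨y, rfl⟩ := Finsupp.exists_p_smul (M.indep z h1)
    obtain ⟨u, hu⟩ := h
    obtain ⟨w, rfl⟩ := ih y ⟨u, by
      refine PDHull.cancel_natCast M.eq_zero_of_natCast_mul hp.out.ne_zero ?_
      rw [← mul_assoc, ← pow_succ', ← hu, psi_natCast_mul, map_mul, map_natCast]⟩
    exact ⟨w, by rw [pow_succ', mul_smul]⟩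

end Theta

end PDModel

section Independence

variable {p : ℕ} [hp : Fact p.Prime] {B : Type u} [CommRing B] [CharP B p] [PerfectRing B p]
  {n : ℕ} {C : Type u} [CommRing C] [CharP C p] (π : PerfPolynomial p B n →+* C)
  [hgp : IsGoodPresentation π]

/-- The elements `x^α / ⌊α⌋!` are linearly independent over `W(B)` modulo each power of `p`. -/
theorem exists_eq_smul_of_p_pow_dvd_psi (N : ℕ) (z : Expo p n →₀ WittVector p B)
    (h : (p : AcrisHull p C) ^ N ∣ psi π z) : ∃ w : Expo p n →₀ WittVector p B, z = p ^ N • w := by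
  obtain ⟨T, _, _, ⟨M⟩⟩ := PDModel.exists_complete p B n
  refine M.exists_eq_smul_of_p_pow_dvd π N z ?_
  have := map_dvd (M.ofHull π) h
  rwa [map_pow, map_natCast] at this

theorem p_dvd_coeff_of_p_dvd_psi {z : Expo p n →₀ WittVector p B}
    (h : (p : AcrisHull p C) ∣ psi π z) (α : Expo p n) : (p : WittVector p B) ∣ z α := by
  obtain ⟨w, rfl⟩ := exists_eq_smul_of_p_pow_dvd_psi π 1 z (by rwa [pow_one])
  exact ⟨w α, by simp⟩

end Independence

/-- Approximate `d` by `psi π z` modulo `p^N`. Independence modulo `p^(N+1)` applied to `p z`, and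
torsion-freeness of `W(B)`, give `p^N ∣ z`. -/
theorem AcrisHull.p_pow_dvd_of_p_mul {p : ℕ} [hp : Fact p.Prime] {B : Type u} [CommRing B]
    [CharP B p] [PerfectRing B p] {n : ℕ} {C : Type u} [CommRing C] [CharP C p]
    (π : PerfPolynomial p B n →+* C) [IsGoodPresentation π] (N : ℕ) (d : AcrisHull p C)
    (h : (p : AcrisHull p C) ^ (N + 1) ∣ p * d) : (p : AcrisHull p C) ^ N ∣ d := by
  obtain ⟨z, hz⟩ := exists_psi_p_pow_dvd_sub π d N
  have h1 : (p : AcrisHull p C) ^ (N + 1) ∣ psi π (p • z) := by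
    rw [psi_natCast_mul]
    have h5 : (p : AcrisHull p C) ^ (N + 1) ∣ p * (d - psi π z) := by
      rw [pow_succ']
      exact mul_dvd_mul_left _ hz
    have h4 := dvd_sub h h5
    rwa [mul_sub, sub_sub_cancel] at h4
  obtain ⟨w, hw⟩ := exists_eq_smul_of_p_pow_dvd_psi π _ _ h1
  have hzw : z = p ^ N • w := by
    ext1 α
    have h5 := DFunLike.congr_fun hw α
    rw [Finsupp.smul_apply, Finsupp.smul_apply, nsmul_eq_mul, nsmul_eq_mul] at h5
    rw [Finsupp.smul_apply, nsmul_eq_mul]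
    refine PDHull.cancel_natCast WittVector.eq_zero_of_natCast_mul hp.out.ne_zero ?_
    rw [h5, ← mul_assoc]
    push_cast
    ring
  rw [hzw, psi_natCast_mul, Nat.cast_pow] at hz
  have := dvd_add hz (dvd_mul_right ((p : AcrisHull p C) ^ N) (psi π w))
  rwa [sub_add_cancel] at this

/-! ### The `p`-adic topology of `A_cris(C)` -/

namespace Acris

section Basic

variable {p : ℕ} [hp : Fact p.Prime] {C : Type u} [CommRing C] [CharP C p]

variable (p C) in
/-- The homomorphism from the divided power hull to `A_cris(C)`. -/
def incl : AcrisHull p C →+* Acris p C :=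
  algebraMap (AcrisHull p C) (AdicCompletion (Ideal.span {(p : AcrisHull p C)}) (AcrisHull p C))

theorem eval_incl (N : ℕ) (d : AcrisHull p C) :
    eval p C N (incl p C d) = Ideal.Quotient.mk _ d :=
  AdicCompletion.evalₐ_of (Ideal.span {(p : AcrisHull p C)}) N d

theorem eval_eq_zero_iff (N : ℕ) (u : Acris p C) :
    eval p C N u = 0 ↔ (p : Acris p C) ^ N ∣ u := by
  refine ⟨fun h => AdicCompletion.exists_eq_p_pow_mul h, ?_⟩
  rintro ⟨v, rfl⟩
  exact AdicCompletion.evalₐ_p_pow_mul N v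

theorem eval_eq_mk_iff (N : ℕ) (u : Acris p C) (d : AcrisHull p C) :
    eval p C N u = Ideal.Quotient.mk _ d ↔ (p : Acris p C) ^ N ∣ u - incl p C d := by
  rw [← eval_eq_zero_iff, map_sub, eval_incl, sub_eq_zero]

theorem exists_dvd_sub_incl (N : ℕ) (u : Acris p C) :
    ∃ d, (p : Acris p C) ^ N ∣ u - incl p C d := by
  obtain ⟨d, hd⟩ := Ideal.Quotient.mk_surjective (eval p C N u)
  exact ⟨d, (eval_eq_mk_iff N u d).1 hd.symm⟩

theorem p_pow_dvd_incl_iff (N : ℕ) (d : AcrisHull p C) :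
    (p : Acris p C) ^ N ∣ incl p C d ↔ (p : AcrisHull p C) ^ N ∣ d := by
  rw [← eval_eq_zero_iff, eval_incl, Ideal.Quotient.eq_zero_iff_mem, Ideal.span_singleton_pow,
    Ideal.mem_span_singleton]

theorem p_dvd_incl_iff (d : AcrisHull p C) :
    (p : Acris p C) ∣ incl p C d ↔ (p : AcrisHull p C) ∣ d := by
  simpa using p_pow_dvd_incl_iff 1 d

theorem eq_zero_of_forall_dvd {u : Acris p C} (h : ∀ N : ℕ, (p : Acris p C) ^ N ∣ u) : u = 0 := by
  refine AdicCompletion.ext_evalₐ fun N => ?_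
  exact ((eval_eq_zero_iff N u).2 (h N)).trans (map_zero (eval p C N)).symm

theorem frob_incl (d : AcrisHull p C) :
    frob p C (incl p C d) = incl p C (hullMap p (frobenius C p) d) := by
  refine AdicCompletion.ext_evalₐ fun N => ?_
  change eval p C N (map p _ _) = eval p C N (incl p C _)
  rw [eval_map, eval_incl, eval_incl, Ideal.quotientMap_mk]

theorem p_pow_dvd_logTeich_sub (c : unitsKer p C) {N M : ℕ} (h : p * N ≤ M) :
    (p : Acris p C) ^ N ∣ logTeich p c - incl p C (logPartialSum p c M) :=
  (eval_eq_mk_iff N _ _).1 (eval_logTeich p c N M h)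

theorem mem_frobEqP_iff (u : Acris p C) : u ∈ frobEqP p C ↔ frob p C u = p * u := by
  rw [frobEqP, AddMonoidHom.mem_ker]
  exact sub_eq_zero

end Basic

section Log

variable {p : ℕ} [hp : Fact p.Prime] {C : Type u} [CommRing C] [CharP C p]

theorem logPartialSum_eq (c : unitsKer p C) (M : ℕ) :
    logPartialSum p c M = -∑ k ∈ Finset.range M,
      (k ! : AcrisHull p C) * gamma p (AcrisIdeal p C) (k + 1) (oneSubTeich p c) := by
  rw [logPartialSum, neg_inj]
  induction M with
  | zero => simp
  | succ M ih =>
    rw [Finset.sum_Icc_succ_top (by omega), ih, Finset.sum_range_succ, Nat.add_sub_cancel]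

/-- The part of `q(q-1)⋯(q-k)` linear in `q` is `(-1)^k k! q`. This converts binomial coefficients
into the coefficients of the logarithm. -/
theorem exists_descFactorial_eq (S : Type*) [CommRing S] (q k : ℕ) (hk : k < q) :
    ∃ c : S, (q.descFactorial (k + 1) : S) = q * ((-1) ^ k * (k ! : S) + q * c) := by
  induction k with
  | zero => exact ⟨0, by simp⟩
  | succ k ih =>
    obtain ⟨c, hc⟩ := ih (by omega)
    refine ⟨(-1) ^ k * (k ! : S) + q * c - (k + 1) * c, ?_⟩
    rw [Nat.descFactorial_succ, Nat.cast_mul, hc, Nat.cast_sub hk.le, Nat.factorial_succ]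
    push_cast
    ring

/-- The Teichmüller representative of `c`, in the divided power hull. -/
def hullTeich (c : unitsKer p C) : AcrisHull p C :=
  of p (AcrisIdeal p C) (WittVector.teichmuller p ((c : (Perfection C p)ˣ) : Perfection C p))

theorem hullTeich_mul (c d : unitsKer p C) : hullTeich (c * d) = hullTeich c * hullTeich d := by
  rw [hullTeich, hullTeich, hullTeich, ← map_mul, ← map_mul]
  rfl

theorem hullTeich_eq (c : unitsKer p C) :
    hullTeich c = -of p (AcrisIdeal p C) (oneSubTeich p c) + 1 := by
  change hullTeich c = -of p (AcrisIdeal p C) (1 - WittVector.teichmuller p _) + 1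
  rw [map_sub, map_one, hullTeich]
  ring

/-- Expand `(1 - y)^q` with `y = 1 - [c]` and use `y^j = j! γ_j(y)`. The coefficient of `γ_(k+1)(y)`
is `(-1)^(k+1) q(q-1)⋯(q-k)`, congruent to `-q k!` modulo `q^2`. -/
theorem sq_dvd_hullTeich_pow_sub (c : unitsKer p C) (q : ℕ) :
    (q : AcrisHull p C) ^ 2 ∣ hullTeich c ^ q - 1 - q * logPartialSum p c q := by
  rw [hullTeich_eq, add_pow, Finset.sum_range_succ', logPartialSum_eq]
  have h0 : ∀ S s : AcrisHull p C, S + (-of p (AcrisIdeal p C) (oneSubTeich p c)) ^ 0 *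
      1 ^ (q - 0) * (q.choose 0 : AcrisHull p C) - 1 - q * -s = S + q * s := fun S s => by
    simp
  rw [h0, Finset.mul_sum, ← Finset.sum_add_distrib]
  refine Finset.dvd_sum fun k hk => ?_
  obtain ⟨a, ha⟩ := exists_descFactorial_eq (AcrisHull p C) q k (Finset.mem_range.1 hk)
  refine ⟨(-1) ^ (k + 1) * a * gamma p (AcrisIdeal p C) (k + 1) (oneSubTeich p c), ?_⟩
  rw [neg_pow, ← factorial_mul_gamma, one_pow, mul_one]
  rw [Nat.descFactorial_eq_factorial_mul_choose] at ha
  push_cast at ha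
  have h1 : ((-1) ^ k * (-1) ^ k : AcrisHull p C) = 1 := by
    rw [← mul_pow]
    simp
  calc _ = (-1) ^ (k + 1) * (((k + 1)! : AcrisHull p C) * (q.choose (k + 1) : AcrisHull p C)) *
        gamma p (AcrisIdeal p C) (k + 1) (oneSubTeich p c) +
        q * ((k ! : AcrisHull p C) * gamma p (AcrisIdeal p C) (k + 1) (oneSubTeich p c)) := by ring
    _ = _ := by
      rw [ha, pow_succ]
      linear_combination (-(q : AcrisHull p C) * (k ! : AcrisHull p C) *
        gamma p (AcrisIdeal p C) (k + 1) (oneSubTeich p c)) * h1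

theorem p_pow_dvd_hullTeich_pow_sub (c : unitsKer p C) (m : ℕ) :
    ((p : Acris p C) ^ m) ^ 2 ∣
      incl p C (hullTeich c) ^ p ^ m - 1 - (p : Acris p C) ^ m * logTeich p c := by
  have h1 := map_dvd (incl p C) (sq_dvd_hullTeich_pow_sub c (p ^ m))
  rw [map_sub, map_sub, map_mul, map_pow, map_pow, map_one, map_natCast] at h1
  -- The partial sum with `p^m` terms is then long enough to be exact modulo `p^m`.
  have hle : p * m ≤ p ^ m := by
    rcases m with _ | m
    · simp
    · rw [pow_succ']
      exact Nat.mul_le_mul_left p (Nat.lt_pow_self hp.out.one_lt)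
  have h2 := mul_dvd_mul_left ((p : Acris p C) ^ m) (p_pow_dvd_logTeich_sub c hle)
  rw [← sq] at h2
  push_cast at h1
  have h3 := dvd_sub h1 h2
  convert h3 using 1
  ring

theorem p_pow_dvd_of_mul (hA : ∀ u : Acris p C, (p : Acris p C) * u = 0 → u = 0) (m N : ℕ)
    {u : Acris p C} (h : (p : Acris p C) ^ (m + N) ∣ (p : Acris p C) ^ m * u) :
    (p : Acris p C) ^ N ∣ u := by
  obtain ⟨v, hv⟩ := h
  refine ⟨v, ?_⟩
  rw [pow_add, mul_assoc, ← sub_eq_zero, ← mul_sub] at hv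
  rw [← sub_eq_zero]
  generalize u - _ = w at hv
  induction m with
  | zero => simpa using hv
  | succ m ih => exact ih (hA _ (by rw [← mul_assoc, ← pow_succ', hv]))

/-- Put `q = p^m`, `x = [c]^q`, `y = [d]^q`. Both `x - 1` and `y - 1` are multiples of `q`, so `xy -
1 ≡ (x - 1) + (y - 1)` modulo `q^2`; dividing by `q` gives additivity modulo `p^m`. -/
theorem logTeich_mul (hA : ∀ u : Acris p C, (p : Acris p C) * u = 0 → u = 0)
    (c d : unitsKer p C) : logTeich p (c * d) = logTeich p c + logTeich p d := by
  refine sub_eq_zero.1 (eq_zero_of_forall_dvd fun m => p_pow_dvd_of_mul hA m m ?_)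
  rw [pow_add, ← sq]
  obtain ⟨a, ha⟩ := p_pow_dvd_hullTeich_pow_sub c m
  obtain ⟨b, hb⟩ := p_pow_dvd_hullTeich_pow_sub d m
  obtain ⟨e, he⟩ := p_pow_dvd_hullTeich_pow_sub (c * d) m
  rw [hullTeich_mul, map_mul, mul_pow] at he
  set q := (p : Acris p C) ^ m
  set x := incl p C (hullTeich c) ^ p ^ m
  set y := incl p C (hullTeich d) ^ p ^ m
  refine ⟨a + b - e + (logTeich p c + q * a) * (logTeich p d + q * b), ?_⟩
  linear_combination ha * y + hb + (q * logTeich p c + q ^ 2 * a) * hb - he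

theorem logTeich_one (hA : ∀ u : Acris p C, (p : Acris p C) * u = 0 → u = 0) :
    logTeich p (1 : unitsKer p C) = 0 := by
  have h := logTeich_mul hA (1 : unitsKer p C) 1
  rw [mul_one] at h
  exact left_eq_add.1 h

/-- The logarithm as a homomorphism. -/
def logHom (hA : ∀ u : Acris p C, (p : Acris p C) * u = 0 → u = 0) :
    Additive (unitsKer p C) →+ Acris p C where
  toFun c := logTeich p c.toMul
  map_zero' := logTeich_one hA
  map_add' c d := logTeich_mul hA c.toMul d.toMul

theorem logTeich_pow (hA : ∀ u : Acris p C, (p : Acris p C) * u = 0 → u = 0)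
    (c : unitsKer p C) (k : ℕ) : logTeich p (c ^ k) = k * logTeich p c := by
  have := map_nsmul (logHom hA) k (Additive.ofMul c)
  rw [nsmul_eq_mul] at this
  exact this

theorem logTeich_div (hA : ∀ u : Acris p C, (p : Acris p C) * u = 0 → u = 0)
    (c d : unitsKer p C) : logTeich p (c / d) = logTeich p c - logTeich p d :=
  map_sub (logHom hA) (Additive.ofMul c) (Additive.ofMul d)

theorem map_frobenius_eq_pow (x : Perfection C p) : Perfection.map p (frobenius C p) x = x ^ p := by
  refine Perfection.ext fun k => ?_
  rw [Perfection.coeff_map, map_pow]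
  rfl

theorem wittMap_oneSubTeich (c : unitsKer p C) :
    wittMap p (frobenius C p) (oneSubTeich p c : WittVector p (Perfection C p)) =
      oneSubTeich p (c ^ p) := by
  change WittVector.map _ (1 - WittVector.teichmuller p _) = 1 - WittVector.teichmuller p _
  rw [map_sub, map_one, WittVector.map_teichmuller, map_frobenius_eq_pow]
  rfl

theorem frob_logTeich (c : unitsKer p C) : frob p C (logTeich p c) = logTeich p (c ^ p) := by
  refine sub_eq_zero.1 (eq_zero_of_forall_dvd fun N => ?_)
  have h1 := map_dvd (frob p C) (p_pow_dvd_logTeich_sub c (le_refl (p * N)))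
  have h2 := p_pow_dvd_logTeich_sub (c ^ p) (le_refl (p * N))
  rw [map_pow, map_natCast, map_sub, frob_incl] at h1
  have h3 : hullMap p (frobenius C p) (logPartialSum p c (p * N)) =
      logPartialSum p (c ^ p) (p * N) := by
    rw [logPartialSum_eq, logPartialSum_eq, map_neg, map_sum]
    congr 1
    refine Finset.sum_congr rfl fun k _ => ?_
    rw [map_mul, map_natCast, hullMap, map_gamma]
    congr 2
    exact Subtype.ext (wittMap_oneSubTeich c)
  rw [h3] at h1
  have h4 := dvd_sub h1 h2
  rwa [sub_sub_sub_cancel_right] at h4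

theorem logTeich_mem_frobEqP (hA : ∀ u : Acris p C, (p : Acris p C) * u = 0 → u = 0)
    (c : unitsKer p C) : logTeich p c ∈ frobEqP p C := by
  rw [mem_frobEqP_iff, frob_logTeich, logTeich_pow hA]

end Log

section TorsionFree

theorem eq_zero_of_p_mul {p : ℕ} [hp : Fact p.Prime] {B : Type u} [CommRing B]
    [CharP B p] [PerfectRing B p] {n : ℕ} {C : Type u} [CommRing C] [CharP C p]
    (π : PerfPolynomial p B n →+* C) [IsGoodPresentation π] (u : Acris p C)
    (hu : (p : Acris p C) * u = 0) : u = 0 :=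
  AdicCompletion.eq_zero_of_p_mul (AcrisHull.p_pow_dvd_of_p_mul π) hu

end TorsionFree

end Acris

/-! ### The Frobenius in terms of the spanning family -/

theorem Expo.smul_eq {p n : ℕ} [hp : Fact p.Prime] (α : Expo p n) :
    p • α = p • Expo.frac α + Expo.ofNat (p • Expo.fl α) := by
  funext i
  refine Subtype.ext ?_
  rw [Pi.add_apply, AddSubmonoid.coe_add, Expo.nsmul_apply, Expo.nsmul_apply, Expo.ofNat_apply,
    Expo.frac_apply, Pi.smul_apply, smul_eq_mul]
  push_cast
  ring

/-- Since `⌊pα_i⌋ = p⌊α_i⌋ + ⌊p{α_i}⌋`, the product splits at `p⌊α_i⌋`. The first block comes from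
`γ_n(x_i^p)`, the second from the integral part of `p` times the fractional exponent. -/
theorem Expo.ratio_eq {p n : ℕ} [hp : Fact p.Prime] (α : Expo p n) :
    (∏ i, (Expo.fl α i + 1).ascFactorial (Expo.fl α i * (p - 1))) *
      ∏ i, ((p • Expo.fl α) i + 1).ascFactorial (Expo.fl (p • Expo.frac α) i) = Expo.ratio α := by
  rw [← Finset.prod_mul_distrib, Expo.ratio]
  refine Finset.prod_congr rfl fun i _ => ?_
  have h1 : Expo.fl (p • α) i = Expo.fl (p • Expo.frac α) i + p * Expo.fl α i := by
    rw [Expo.smul_eq, Expo.fl_add_ofNat]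
    rfl
  have h2 : Expo.fl α i * (p - 1) + Expo.fl α i = p * Expo.fl α i := by
    rw [← Nat.mul_succ, Nat.succ_eq_add_one, Nat.sub_add_cancel hp.out.one_le, mul_comm]
  have h3 : (p • Expo.fl α) i + 1 = Expo.fl α i + 1 + Expo.fl α i * (p - 1) := by
    rw [Pi.smul_apply, smul_eq_mul, ← h2]
    ring
  rw [h3, Nat.ascFactorial_mul_ascFactorial, h1]
  congr 1
  omega

section Coefficients

variable {p : ℕ} [hp : Fact p.Prime] {B : Type u} [CommRing B] {n : ℕ}

theorem p_dvd_of_p_dvd_natCast_mul {k : ℕ} (hk : ¬ p ∣ k) {a : WittVector p B}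
    (h : (p : WittVector p B) ∣ k * a) : (p : WittVector p B) ∣ a := by
  have hc : IsCoprime (p : WittVector p B) (k : WittVector p B) :=
    ((Nat.Prime.coprime_iff_not_dvd hp.out).2 hk).cast (R := WittVector p B)
  exact hc.dvd_of_dvd_mul_left h

/-- The coefficients of the linear part of the logarithm. -/
def logCoeff (r : PerfPolynomial p B n) : Expo p n →₀ WittVector p B :=
  r.coeff.sum fun α b => Finsupp.single α ((Expo.fact α : WittVector p B) *
    WittVector.teichmuller p b)

theorem logCoeff_apply (r : PerfPolynomial p B n) (α : Expo p n) :
    logCoeff r α = (Expo.fact α : WittVector p B) * WittVector.teichmuller p (r.coeff α) := by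
  classical
  rw [logCoeff, Finsupp.sum, Finsupp.finsetSum_apply]
  simp only [Finsupp.single_apply]
  rw [Finset.sum_ite_eq']
  split_ifs with h
  · rfl
  · rw [Finsupp.notMem_support_iff.1 h, WittVector.teichmuller_zero, mul_zero]

/-- The map on families of coefficients which describes the Frobenius. -/
def frobCoeff (p : ℕ) [Fact p.Prime] (B : Type u) [CommRing B] [CharP B p] (n : ℕ) :
    (Expo p n →₀ WittVector p B) →+ (Expo p n →₀ WittVector p B) :=
  Finsupp.liftAddHom fun α => (Finsupp.singleAddHom (p • α)).comp
    ((AddMonoidHom.mulLeft (Expo.ratio α : WittVector p B)).comp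
      (WittVector.map (frobenius B p)).toAddMonoidHom)

theorem frobCoeff_single [CharP B p] (α : Expo p n) (a : WittVector p B) :
    frobCoeff p B n (Finsupp.single α a) =
      Finsupp.single (p • α) ((Expo.ratio α : WittVector p B) * WittVector.map (frobenius B p) a) :=
  Finsupp.liftAddHom_apply_single _ _ _

theorem frobCoeff_apply [CharP B p] (z : Expo p n →₀ WittVector p B) (α : Expo p n) :
    frobCoeff p B n z (p • α) =
      (Expo.ratio α : WittVector p B) * WittVector.map (frobenius B p) (z α) := by
  classical
  induction z using Finsupp.induction_linear with
  | zero => simp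
  | add f g hf hg =>
    rw [map_add, Finsupp.add_apply, Finsupp.add_apply, hf, hg, map_add, mul_add]
  | single β a =>
    rw [frobCoeff_single, Finsupp.single_apply, Finsupp.single_apply]
    by_cases h : β = α
    · rw [if_pos h, if_pos (by rw [h]), h]
    · rw [if_neg h, if_neg fun e => h (Expo.smul_injective e), map_zero, mul_zero]

end Coefficients

section Frobenius

variable {p : ℕ} [hp : Fact p.Prime] {B : Type u} [CommRing B] [CharP B p] [PerfectRing B p]
  {n : ℕ} {C : Type u} [CommRing C] [CharP C p] (π : PerfPolynomial p B n →+* C)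

theorem wittMap_iotaW (a : WittVector p B) :
    Acris.wittMap p (frobenius C p) (iotaW π a) =
      iotaW π (WittVector.map (frobenius B p) a) := by
  refine WittVector.ext fun k => ?_
  rw [Acris.wittMap, iotaW, WittVector.map_coeff, WittVector.map_coeff, WittVector.map_coeff,
    WittVector.map_coeff, Acris.map_frobenius_eq_pow, frobenius_def, map_pow]

theorem wittMap_mono (α : Expo p n) :
    Acris.wittMap p (frobenius C p) (mono π α) = mono π α ^ p := by
  rw [mono_def, Acris.wittMap, WittVector.map_teichmuller, Acris.map_frobenius_eq_pow, map_pow]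

variable [hgp : IsGoodPresentation π]

theorem hullMap_basisElt (α : Expo p n) :
    Acris.hullMap p (frobenius C p) (basisElt π α) =
      (Expo.ratio α : AcrisHull p C) * basisElt π (p • α) := by
  rw [basisElt, map_mul, map_prod, Acris.hullMap, map_of, wittMap_mono, ← mono_nsmul]
  have h : ∀ i, PDHull.map p (Acris.wittMap p (frobenius C p))
      (Acris.wittMap_mem_ker p (frobenius C p)) (gamma p (AcrisIdeal p C) (Expo.fl α i)
        (xker π i)) = ((Expo.fl α i + 1).ascFactorial (Expo.fl α i * (p - 1)) : AcrisHull p C) *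
        gamma p (AcrisIdeal p C) ((p • Expo.fl α) i) (xker π i) := fun i => by
    rw [map_gamma]
    exact gamma_pow_p _ _ _ (wittMap_mono π _)
  rw [Finset.prod_congr rfl fun i _ => h i, Finset.prod_mul_distrib, mul_left_comm,
    of_mono_mul_prod, ← Expo.smul_eq, ← Expo.ratio_eq]
  push_cast
  ring

theorem hullMap_psi (z : Expo p n →₀ WittVector p B) :
    Acris.hullMap p (frobenius C p) (psi π z) = psi π (frobCoeff p B n z) := by
  induction z using Finsupp.induction_linear with
  | zero => simp
  | add f g hf hg => simp only [map_add, hf, hg]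
  | single α a =>
    rw [psi_single, map_mul, hullMap_basisElt, frobCoeff_single, psi_single, Acris.hullMap,
      map_of, wittMap_iotaW, map_mul, map_mul, map_natCast, map_natCast]
    ring

theorem p_dvd_of_p_dvd_map_frobenius {a : WittVector p B}
    (h : (p : WittVector p B) ∣ WittVector.map (frobenius B p) a) : (p : WittVector p B) ∣ a := by
  rw [WittVector.p_dvd_iff] at h ⊢
  rw [WittVector.map_coeff, frobenius_def] at h
  exact injective_pow_p B p (by rw [h, zero_pow hp.out.ne_zero])

/-- An element of `A_cris(C)^{F = p}` whose coefficients on a fundamental domain for multiplication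
by `p` are divisible by `p` is divisible by `p`. -/
theorem p_dvd_of_mem_frobEqP {u : Acris p C} (hu : u ∈ Acris.frobEqP p C)
    {z : Expo p n →₀ WittVector p B} (hz : (p : Acris p C) ∣ u - Acris.incl p C (psi π z))
    (h : ∀ α : Expo p n, Expo.Big α → (∀ i, (α i : ℚ) < p) → (p : WittVector p B) ∣ z α) :
    (p : Acris p C) ∣ u := by
  -- Precision `p^2` is needed because the relation obtained from `F(u) = p u` will be divided by
  -- `p`.
  obtain ⟨d, hd⟩ := Acris.exists_dvd_sub_incl 2 u
  obtain ⟨w, hw⟩ := exists_psi_p_pow_dvd_sub π d 2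
  have hw' : (p : Acris p C) ^ 2 ∣ u - Acris.incl p C (psi π w) := by
    have h1 := dvd_add hd ((Acris.p_pow_dvd_incl_iff 2 _).2 hw)
    rwa [map_sub, sub_add_sub_cancel] at h1
  have hw1 : (p : Acris p C) ∣ u - Acris.incl p C (psi π w) :=
    (dvd_pow_self _ two_ne_zero).trans hw'
  have hS : ∀ α : Expo p n, Expo.Big α → (∀ i, (α i : ℚ) < p) → (p : WittVector p B) ∣ w α := by
    intro α h1 h2
    have h3 := dvd_sub hz hw1
    rw [sub_sub_sub_cancel_left, ← map_sub, Acris.p_dvd_incl_iff, ← map_sub] at h3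
    have h4 := p_dvd_coeff_of_p_dvd_psi π h3 α
    rw [Finsupp.sub_apply] at h4
    exact (dvd_iff_dvd_of_dvd_sub h4).2 (h α h1 h2)
  -- These are the coefficients at `pα` of `F(u) = p u`, compared modulo `p^2` by independence.
  have hF : ∀ α : Expo p n, (p : WittVector p B) ^ 2 ∣
      (Expo.ratio α : WittVector p B) * WittVector.map (frobenius B p) (w α) - p * w (p • α) := by
    intro α
    have h1 := map_dvd (Acris.frob p C) hw'
    rw [map_pow, map_natCast, map_sub, (Acris.mem_frobEqP_iff u).1 hu, Acris.frob_incl,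
      hullMap_psi] at h1
    have h2 := dvd_sub (hw'.mul_left (p : Acris p C)) h1
    rw [mul_sub, sub_sub_sub_cancel_left, ← map_natCast (Acris.incl p C), ← map_mul, ← map_sub,
      map_natCast, Acris.p_pow_dvd_incl_iff, ← psi_natCast_mul, ← map_sub] at h2
    obtain ⟨v, hv⟩ := exists_eq_smul_of_p_pow_dvd_psi π 2 _ h2
    refine ⟨v (p • α), ?_⟩
    have h3 := DFunLike.congr_fun hv (p • α)
    rw [Finsupp.sub_apply, frobCoeff_apply, Finsupp.smul_apply, Finsupp.smul_apply, nsmul_eq_mul,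
      nsmul_eq_mul] at h3
    rw [h3]
    push_cast
    rfl
  -- If `β` is not big, `ratio β` is prime to `p` and `hF` at `β` suffices. If `β` is big but `β/p`
  -- is not, `β` is in the fundamental domain. Otherwise `p ∣ ratio (β/p)`, and `hF` at `β/p`,
  -- divided by `p`, carries divisibility from `β/p` to `β`.
  have hall : ∀ (N : ℕ) (β : Expo p n), (∀ i, (β i : ℚ) < (p : ℚ) ^ (N + 1)) →
      (p : WittVector p B) ∣ w β := by
    intro N
    have hnb : ∀ β : Expo p n, ¬ Expo.Big β → (p : WittVector p B) ∣ w β := by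
      intro β hβ
      have h1 := dvd_add ((dvd_pow_self _ two_ne_zero).trans (hF β))
        (dvd_mul_right (p : WittVector p B) (w (p • β)))
      rw [sub_add_cancel] at h1
      exact p_dvd_of_p_dvd_map_frobenius
        (p_dvd_of_p_dvd_natCast_mul (Expo.not_dvd_ratio hβ) h1)
    induction N with
    | zero =>
      intro β hβ
      by_cases h1 : Expo.Big β
      · exact hS β h1 (by simpa using hβ)
      · exact hnb β h1
    | succ N ih =>
      intro β hβ
      by_cases h1 : Expo.Big (Expo.divP β)
      · have h2 := ih (Expo.divP β) fun i => by
          rw [Expo.divP_apply, div_lt_iff₀ Expo.p_cast_pos, ← pow_succ]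
          exact hβ i
        have h3 := hF (Expo.divP β)
        obtain ⟨k, hk⟩ := Expo.dvd_ratio h1
        obtain ⟨a, ha⟩ := h2
        rw [Expo.smul_divP, hk, ha, Nat.cast_mul, mul_assoc, ← mul_sub, sq] at h3
        obtain ⟨b, hb⟩ := h3
        rw [mul_assoc] at hb
        have h4 := PDHull.cancel_natCast WittVector.eq_zero_of_natCast_mul hp.out.ne_zero hb
        rw [map_mul, map_natCast] at h4
        exact ⟨k * WittVector.map (frobenius B p) a - b, by
          linear_combination -h4⟩
      · by_cases h2 : Expo.Big β
        · refine hS β h2 fun i => ?_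
          rw [← one_mul (p : ℚ), ← div_lt_iff₀ Expo.p_cast_pos]
          exact not_le.1 fun hi => h1 ⟨i, hi⟩
        · exact hnb β h2
  have hw0 : ∀ β, (p : WittVector p B) ∣ w β := fun β => by
    obtain ⟨N, hN⟩ := pow_unbounded_of_one_lt (Expo.deg β)
      (show (1 : ℚ) < p by exact_mod_cast hp.out.one_lt)
    refine hall N β fun i => ?_
    refine (Finset.single_le_sum (f := fun i => (β i : ℚ)) (fun i _ => Expo.coe_nonneg (β i))
      (Finset.mem_univ i)).trans_lt (hN.trans ?_)
    exact pow_lt_pow_right₀ (by exact_mod_cast hp.out.one_lt) (Nat.lt_succ_self N)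
  obtain ⟨v, rfl⟩ := Finsupp.exists_p_smul hw0
  rw [psi_natCast_mul, map_mul, map_natCast] at hw1
  have h1 := dvd_add hw1 (dvd_mul_right (p : Acris p C) (Acris.incl p C (psi π v)))
  rwa [sub_add_cancel] at h1

end Frobenius

/-! ### The logarithm modulo `p` -/

section LogMod

variable {p : ℕ} [hp : Fact p.Prime] {B : Type u} [CommRing B] [CharP B p] [PerfectRing B p]
  {n : ℕ} {C : Type u} [CommRing C] [CharP C p] (π : PerfPolynomial p B n →+* C)
  [hgp : IsGoodPresentation π]

theorem psi_logCoeff (r : PerfPolynomial p B n) :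
    psi π (logCoeff r) = of p (AcrisIdeal p C) (∑ α ∈ r.coeff.support,
      iotaW π (WittVector.teichmuller p (r.coeff α)) * mono π α) := by
  rw [logCoeff, Finsupp.sum, map_sum, map_sum]
  refine Finset.sum_congr rfl fun α _ => ?_
  rw [psi_single, map_mul, map_mul, map_mul, of_mono, map_natCast, map_natCast]
  ring

/-- The logarithm is given by its linear part, up to terms of twice the degree. -/
theorem logPartialSum_sub_psi_mem (c : Acris.unitsKer p C) (r : PerfPolynomial p B n)
    (hr : Perfection.coeff C p 1
      (((c : (Perfection C p)ˣ) : Perfection C p) - 1 - lam π r) = 0) {d : ℚ} (hd : 0 ≤ d)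
    (hbig : ∀ α ∈ r.coeff.support, Expo.Big α ∧ d ≤ Expo.deg α) :
    Acris.logPartialSum p c p - psi π (logCoeff r) ∈ degFil π (2 * d) := by
  set y := Acris.oneSubTeich p c with hy
  have hy0 : (y : WittVector p (Perfection C p)).coeff 0 =
      1 - ((c : (Perfection C p)ˣ) : Perfection C p) := by
    change WittVector.constantCoeff ((1 : WittVector p (Perfection C p)) -
      WittVector.teichmuller p _) = _
    rw [map_sub, map_one, WittVector.constantCoeff_apply, WittVector.teichmuller_coeff_zero]
  have hgood : DegGood π d y := by
    -- The sign appears because `y` reduces to `1 - c` while `r` represents `c - 1`.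
    refine degGood_of_representative π y (-r) ?_ fun α hα => hbig α ?_
    · have e : 1 - ((c : (Perfection C p)ˣ) : Perfection C p) - lam π (-r) =
          -(((c : (Perfection C p)ˣ) : Perfection C p) - 1 - lam π r) := by
        rw [map_neg]
        ring
      rw [hy0, e, map_neg, hr, neg_zero]
    · rw [Finsupp.mem_support_iff] at hα ⊢
      intro h0
      exact hα (by simp [h0])
  obtain ⟨t, z, hx⟩ := exists_witt_decomposition π (-(y : WittVector p (Perfection C p))) r (by
    rw [← WittVector.constantCoeff_apply, map_neg, WittVector.constantCoeff_apply, hy0, neg_sub]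
    exact hr)
  obtain ⟨q, hq⟩ : ∃ q, p = q + 1 := ⟨p - 1, (Nat.sub_add_cancel hp.out.one_le).symm⟩
  have hsum : Acris.logPartialSum p c p = of p (AcrisIdeal p C) (-(y : WittVector p _)) -
      ∑ k ∈ Finset.range q, ((k + 1)! : AcrisHull p C) *
        gamma p (AcrisIdeal p C) (k + 1 + 1) y := by
    have : ∀ M, M = q + 1 → Acris.logPartialSum p c M = of p (AcrisIdeal p C) (-(y : WittVector p _)) -
      ∑ k ∈ Finset.range q, ((k + 1)! : AcrisHull p C) *
        gamma p (AcrisIdeal p C) (k + 1 + 1) y := by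
      rintro _ rfl
      rw [Acris.logPartialSum_eq, Finset.sum_range_succ', zero_add, gamma_one, map_neg,
        Nat.factorial_zero, Nat.cast_one, one_mul]
      ring
    exact this p hq
  rw [hsum, hx, map_add, map_add, psi_logCoeff, map_mul, map_natCast, map_pow]
  -- All remaining divided powers have index at least 2, hence degree at least `2 d`.
  have hrest : ∑ k ∈ Finset.range q, ((k + 1)! : AcrisHull p C) *
        gamma p (AcrisIdeal p C) (k + 1 + 1) y ∈ degFil π (2 * d) := by
    refine sum_mem fun k _ => natCast_mul_mem_degFil π _ (degFil_mono π ?_ (hgood _))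
    refine mul_le_mul_of_nonneg_right ?_ hd
    push_cast
    linarith [(Nat.cast_nonneg k : (0 : ℚ) ≤ k)]
  have h1 : of p (AcrisIdeal p C) (t : WittVector p (Perfection C p)) ^ p +
      p * of p (AcrisIdeal p C) z ∈ degFil π (2 * d) :=
    mem_degFil_of_dvd π (dvd_add (p_dvd_of_pow t) (dvd_mul_right _ _))
  convert sub_mem h1 hrest using 1
  ring

end LogMod

/-! ### Units of the tilt -/

section Units

variable {p : ℕ} [hp : Fact p.Prime] {C : Type u} [CommRing C] [CharP C p]

/-- Each coefficient satisfies `x_i^(p^i) = x_0 = 1`, so its inverse is `x_i^(p^i - 1)`; these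
inverses are compatible with Frobenius. -/
theorem Perfection.isUnit_of_coeff_zero_eq_one (x : Perfection C p) (hx : coeff C p 0 x = 1) :
    IsUnit x := by
  have h1 : ∀ i, coeff C p i x ^ p ^ i = 1 := fun i => by
    rw [← hx, ← coeff_pow_p_pow x 0 i, zero_add, map_pow]
  have h5 : ∀ i, (coeff C p (i + 1) x ^ (p ^ (i + 1) - 1)) ^ p = coeff C p i x ^ (p ^ i - 1) := by
    intro i
    have h2 : (p ^ (i + 1) - 1) = (p ^ i - 1) + p ^ i * (p - 1) := by
      have h3 : 1 ≤ p ^ i := Nat.one_le_pow _ _ hp.out.pos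
      have h4 : p ^ i * (p - 1) + p ^ i = p ^ (i + 1) := by
        rw [← Nat.mul_succ, Nat.succ_eq_add_one, Nat.sub_add_cancel hp.out.one_le, pow_succ]
      omega
    rw [pow_right_comm, coeff_pow_p', h2, pow_add, pow_mul, h1, one_pow, mul_one]
  let y : Perfection C p := ⟨fun i => coeff C p i x ^ (p ^ i - 1), h5⟩
  have hy : ∀ i, coeff C p i y = coeff C p i x ^ (p ^ i - 1) := fun i => rfl
  refine IsUnit.of_mul_eq_one y (Perfection.ext fun i => ?_)
  rw [map_mul, map_one, hy, ← pow_succ', Nat.sub_add_cancel (Nat.one_le_pow _ _ hp.out.pos), h1]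

namespace Acris

/-- The underlying element of the tilt. -/
abbrev tiltVal (c : unitsKer p C) : Perfection C p := ((c : (Perfection C p)ˣ) : Perfection C p)

theorem coeff_zero_tiltVal (c : unitsKer p C) : Perfection.coeff C p 0 (tiltVal c) = 1 :=
  congrArg Units.val c.2

theorem exists_tiltVal_eq (x : Perfection C p) (hx : Perfection.coeff C p 0 x = 1) :
    ∃ c : unitsKer p C, tiltVal c = x := by
  obtain ⟨v, rfl⟩ := Perfection.isUnit_of_coeff_zero_eq_one x hx
  exact ⟨⟨v, Units.ext hx⟩, rfl⟩

theorem tiltVal_injective : Function.Injective (tiltVal : unitsKer p C → Perfection C p) :=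
  fun _ _ h => Subtype.ext (Units.ext h)

/-- Together with `coeff_tiltVal_pow`, this identifies the `p^m`-th powers in `H` with the elements
whose `m`-th coefficient is 1. It links the `p`-adic filtration on logarithms to convergence in
`C^♭`. -/
theorem exists_eq_pow_of_coeff_eq_one (c : unitsKer p C) (m : ℕ)
    (h : Perfection.coeff C p m (tiltVal c) = 1) : ∃ d : unitsKer p C, c = d ^ p ^ m := by
  obtain ⟨y, hy, hy0⟩ := Perfection.exists_root (tiltVal c) m
  obtain ⟨d, rfl⟩ := exists_tiltVal_eq y (hy0.trans h)
  exact ⟨d, tiltVal_injective hy.symm⟩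

theorem coeff_tiltVal_pow (c : unitsKer p C) {i m : ℕ} (h : i ≤ m) :
    Perfection.coeff C p i (tiltVal (c ^ p ^ m)) = 1 := by
  obtain ⟨j, rfl⟩ := Nat.exists_eq_add_of_le h
  have h1 := Perfection.coeff_pow_p_pow (tiltVal c) 0 i
  rw [zero_add, coeff_zero_tiltVal] at h1
  change Perfection.coeff C p i (tiltVal c ^ p ^ (i + j)) = 1
  rw [pow_add, pow_mul, map_pow, h1, one_pow]

theorem p_dvd_logTeich_sub (c : unitsKer p C) :
    (p : Acris p C) ∣ logTeich p c - incl p C (logPartialSum p c p) := by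
  simpa using p_pow_dvd_logTeich_sub c (N := 1) (M := p) (by rw [mul_one])

end Acris

end Units

/-! ### The logarithm is an isomorphism -/

namespace Acris

section LogIso

variable {p : ℕ} [hp : Fact p.Prime] {B : Type u} [CommRing B] [CharP B p] [PerfectRing B p]
  {n : ℕ} {C : Type u} [CommRing C] [CharP C p]

/-- If the representative `r` of `c - 1` in the fundamental domain were nonzero, take `α` of least
degree in it. The coefficient of `log[c]` there is `⌊α⌋! [r_α]` modulo `p`, since corrections have
degree at least `2 deg α > deg α`; as `⌊α⌋!` is prime to `p`, this forces `r_α = 0`. -/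
theorem coeff_one_eq_one_of_p_dvd_logTeich (π : PerfPolynomial p B n →+* C)
    [hgp : IsGoodPresentation π] (c : unitsKer p C)
    (h : (p : Acris p C) ∣ logTeich p c) : Perfection.coeff C p 1 (tiltVal c) = 1 := by
  obtain ⟨r, hr, hbig⟩ := exists_small_representative π hgp.surjective hgp.ker_eq (tiltVal c - 1)
    (by rw [map_sub, coeff_zero_tiltVal, map_one, sub_self])
  suffices h0 : r = 0 by
    rw [h0, map_zero, sub_zero, map_sub, map_one] at hr
    exact sub_eq_zero.1 hr
  by_contra hr0
  have hne : r.coeff.support.Nonempty := by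
    rw [Finsupp.support_nonempty_iff]
    intro h1
    exact hr0 (AddMonoidAlgebra.ext (by rw [h1, AddMonoidAlgebra.coeff_zero]))
  obtain ⟨α, hα, hmin⟩ := Finset.exists_min_image r.coeff.support Expo.deg hne
  have h1 := logPartialSum_sub_psi_mem π c r hr (Expo.deg_nonneg α)
    fun β hβ => ⟨(hbig β hβ).1, hmin β hβ⟩
  have h2 : (p : AcrisHull p C) ∣ logPartialSum p c p := by
    have h3 := dvd_sub h (p_dvd_logTeich_sub c)
    rwa [sub_sub_cancel, p_dvd_incl_iff] at h3
  obtain ⟨w, hw, hpw⟩ := h1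
  have h3 := dvd_sub h2 hpw
  rw [sub_sub, sub_sub_cancel, ← map_add] at h3
  have h4 := p_dvd_coeff_of_p_dvd_psi π h3 α
  have h5 := Expo.one_le_deg (hbig α hα).1
  rw [Finsupp.add_apply, hw α (by linarith), add_zero, logCoeff_apply] at h4
  have h6 := p_dvd_of_p_dvd_natCast_mul (Expo.not_dvd_fact (hbig α hα).2) h4
  rw [WittVector.p_dvd_iff, WittVector.teichmuller_coeff_zero] at h6
  exact Finsupp.mem_support_iff.1 hα h6

/-- A root `d` of `c` again has zero logarithm by torsion-freeness, so `c` is a `p^m`-th power in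
`H` for every `m`, and all its coefficients equal 1. -/
theorem eq_one_of_logTeich_eq_zero (π : PerfPolynomial p B n →+* C)
    [hgp : IsGoodPresentation π] (c : unitsKer p C) (h : logTeich p c = 0) : c = 1 := by
  have hA := eq_zero_of_p_mul π
  have key : ∀ m : ℕ, ∃ d : unitsKer p C, c = d ^ p ^ m ∧ logTeich p d = 0 := by
    intro m
    induction m with
    | zero => exact ⟨c, by simp, h⟩
    | succ m ih =>
      obtain ⟨d, hd, hd0⟩ := ih
      obtain ⟨e, he⟩ := exists_eq_pow_of_coeff_eq_one d 1
        (coeff_one_eq_one_of_p_dvd_logTeich π d (by rw [hd0]; exact dvd_zero _))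
      rw [pow_one] at he
      refine ⟨e, by rw [hd, he, ← pow_mul, ← pow_succ'], hA _ ?_⟩
      rw [← logTeich_pow hA, ← he, hd0]
  refine tiltVal_injective (Perfection.ext fun m => ?_)
  obtain ⟨d, hd, -⟩ := key m
  rw [hd, coeff_tiltVal_pow d le_rfl]
  exact (map_one (Perfection.coeff C p m)).symm

/-- One step of the approximation of an element of `A_cris(C)^{F = p}` by a logarithm: the degree
of the leading term doubles. -/
theorem exists_logTeich_doubling (π : PerfPolynomial p B n →+* C)
    [hgp : IsGoodPresentation π] (u : Acris p C) (z : Expo p n →₀ WittVector p B)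
    (hz : (p : Acris p C) ∣ u - incl p C (psi π z)) {d : ℚ} (hd : 0 ≤ d)
    (hzd : ∀ α : Expo p n, Expo.Big α → (∀ i, (α i : ℚ) < p) → Expo.deg α < d →
      (p : WittVector p B) ∣ z α) :
    ∃ (c : unitsKer p C) (w : Expo p n →₀ WittVector p B),
      (p : Acris p C) ∣ u - logTeich p c - incl p C (psi π w) ∧
      ∀ α : Expo p n, Expo.Big α → (∀ i, (α i : ℚ) < p) → Expo.deg α < 2 * d →
        (p : WittVector p B) ∣ w α := by
  classical
  let q : Expo p n → Prop := fun α => Expo.Big α ∧ ∀ i, (α i : ℚ) < p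
  have hunit : ∀ α, q α → IsUnit (Expo.fact α : B) := fun α hα => by
    rw [CharP.isUnit_natCast_iff hp.out]
    exact Expo.not_dvd_fact hα.2
  -- On the fundamental domain `⌊α⌋!` is a unit of `B`. Dividing by it makes the linear part of
  -- `log[1 + r]` agree with `z` there modulo `p`.
  let r : PerfPolynomial p B n := .ofCoeff (Finsupp.onFinset z.support
    (fun α => if q α then Ring.inverse (Expo.fact α : B) * (z α).coeff 0 else 0) fun α hα =>
      Finsupp.mem_support_iff.2 fun h0 => hα (by
        rw [h0, WittVector.zero_coeff, mul_zero, ite_self]))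
  have hr : ∀ α, r.coeff α =
      if q α then Ring.inverse (Expo.fact α : B) * (z α).coeff 0 else 0 := fun α => rfl
  have hbig : ∀ α ∈ r.coeff.support, Expo.Big α ∧ d ≤ Expo.deg α := by
    intro α hα
    rw [Finsupp.mem_support_iff, hr] at hα
    by_cases hq : q α
    · refine ⟨hq.1, not_lt.1 fun hlt => hα ?_⟩
      rw [if_pos hq, (WittVector.p_dvd_iff _).1 (hzd α hq.1 hq.2 hlt), mul_zero]
    · exact absurd (if_neg hq) hα
  obtain ⟨c, hc⟩ := exists_tiltVal_eq (1 + lam π r) (by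
    rw [map_add, map_one, coeff_zero_lam, (map_eq_zero_iff_big π hgp.ker_eq r).2
      fun α hα => (hbig α hα).1, add_zero])
  obtain ⟨w, hw, hpw⟩ := logPartialSum_sub_psi_mem π c r (by
    rw [show ((c : (Perfection C p)ˣ) : Perfection C p) = 1 + lam π r from hc, add_sub_cancel_left,
      sub_self, map_zero]) hd hbig
  refine ⟨c, z - logCoeff r - w, ?_, fun α h1 h2 h3 => ?_⟩
  · have h4 := dvd_add (p_dvd_logTeich_sub c) ((p_dvd_incl_iff _).2 hpw)
    have h5 := dvd_sub hz h4
    convert h5 using 1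
    simp only [map_sub]
    ring
  · rw [Finsupp.sub_apply, Finsupp.sub_apply, hw α h3, sub_zero, logCoeff_apply,
      WittVector.p_dvd_sub_iff, ← WittVector.constantCoeff_apply (_ * _), map_mul, map_natCast,
      WittVector.constantCoeff_apply, WittVector.teichmuller_coeff_zero, hr, if_pos ⟨h1, h2⟩,
      ← mul_assoc, Ring.mul_inverse_cancel _ (hunit α ⟨h1, h2⟩), one_mul]

theorem exists_p_dvd_sub_logTeich (π : PerfPolynomial p B n →+* C)
    [hgp : IsGoodPresentation π] {u : Acris p C} (hu : u ∈ frobEqP p C) :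
    ∃ c : unitsKer p C, (p : Acris p C) ∣ u - logTeich p c := by
  have hA := eq_zero_of_p_mul π
  -- Degrees on the fundamental domain are at most `n p`, so after `j` doublings of `d` no exponent
  -- there remains and `p_dvd_of_mem_frobEqP` applies.
  have key : ∀ (j : ℕ) (d : ℚ), 0 ≤ d → (n * p : ℚ) < d * 2 ^ j → ∀ u ∈ frobEqP p C,
      ∀ z : Expo p n →₀ WittVector p B, (p : Acris p C) ∣ u - incl p C (psi π z) →
      (∀ α : Expo p n, Expo.Big α → (∀ i, (α i : ℚ) < p) → Expo.deg α < d →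
        (p : WittVector p B) ∣ z α) → ∃ c : unitsKer p C, (p : Acris p C) ∣ u - logTeich p c := by
    intro j
    induction j with
    | zero =>
      intro d hd0 hd u hu z hz hzd
      refine ⟨1, ?_⟩
      rw [logTeich_one hA, sub_zero]
      refine p_dvd_of_mem_frobEqP π hu hz fun α h1 h2 => hzd α h1 h2 ?_
      rw [pow_zero, mul_one] at hd
      refine lt_of_le_of_lt ?_ hd
      have := Finset.sum_le_card_nsmul Finset.univ (fun i => (α i : ℚ)) p fun i _ => (h2 i).le
      rwa [Finset.card_univ, Fintype.card_fin, nsmul_eq_mul] at this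
    | succ j ih =>
      intro d hd0 hd u hu z hz hzd
      obtain ⟨c, w, hw, hwd⟩ := exists_logTeich_doubling π u z hz hd0 hzd
      obtain ⟨e, he⟩ := ih (2 * d) (by positivity) (by rw [pow_succ] at hd; linarith)
        (u - logTeich p c) (sub_mem hu (logTeich_mem_frobEqP hA c)) w hw hwd
      exact ⟨c * e, by rwa [logTeich_mul hA, ← sub_sub]⟩
  obtain ⟨x, hx⟩ := exists_dvd_sub_incl 1 u
  obtain ⟨z, hz⟩ := exists_psi_p_dvd_sub π x
  obtain ⟨j, hj⟩ := pow_unbounded_of_one_lt (n * p : ℚ) one_lt_two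
  -- The start `d = 1` costs nothing: big exponents have degree at least 1.
  refine key j 1 zero_le_one (by rwa [one_mul]) u hu z ?_ fun α h1 _ h2 =>
    absurd (Expo.one_le_deg h1) (not_le.2 h2)
  rw [pow_one] at hx
  have h1 := dvd_add hx ((p_dvd_incl_iff _).2 hz)
  rwa [map_sub, sub_add_sub_cancel] at h1

/-- Write `u - log[c] = p^m v`; by torsion-freeness `v` also satisfies `F = p`. If `log[e]`
approximates `v` modulo `p`, then `c e^(p^m)` improves `c`, and the factor `e^(p^m)` leaves the
`m`-th coefficient unchanged. -/
theorem exists_logTeich_refinement (π : PerfPolynomial p B n →+* C)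
    [hgp : IsGoodPresentation π] {u : Acris p C} (hu : u ∈ frobEqP p C) (m : ℕ)
    (c : unitsKer p C) (hc : (p : Acris p C) ^ m ∣ u - logTeich p c) :
    ∃ d : unitsKer p C, (p : Acris p C) ^ (m + 1) ∣ u - logTeich p d ∧
      Perfection.coeff C p m (tiltVal d) = Perfection.coeff C p m (tiltVal c) := by
  have hA := eq_zero_of_p_mul π
  obtain ⟨v, hv⟩ := hc
  have hv' : v ∈ frobEqP p C := by
    have h1 := sub_mem hu (logTeich_mem_frobEqP hA c)
    rw [mem_frobEqP_iff] at h1 ⊢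
    rw [hv, map_mul, map_pow, map_natCast] at h1
    refine sub_eq_zero.1 (eq_zero_of_forall_dvd fun N => p_pow_dvd_of_mul hA m N ?_)
    rw [mul_sub, h1, mul_left_comm, sub_self]
    exact dvd_zero _
  obtain ⟨e, w, he⟩ := exists_p_dvd_sub_logTeich π hv'
  refine ⟨c * e ^ p ^ m, ⟨w, ?_⟩, ?_⟩
  · rw [logTeich_mul hA, logTeich_pow hA, ← sub_sub, hv, pow_succ, mul_assoc, ← he]
    push_cast
    ring
  · change Perfection.coeff C p m (tiltVal c * tiltVal (e ^ p ^ m)) = _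
    rw [map_mul, coeff_tiltVal_pow e le_rfl, mul_one]

theorem exists_logTeich_eq (π : PerfPolynomial p B n →+* C)
    [hgp : IsGoodPresentation π] {u : Acris p C} (hu : u ∈ frobEqP p C) :
    ∃ c : unitsKer p C, logTeich p c = u := by
  have hA := eq_zero_of_p_mul π
  choose f hf using fun (m : ℕ)
    (c : {c : unitsKer p C // (p : Acris p C) ^ m ∣ u - logTeich p c}) =>
      exists_logTeich_refinement π hu m c.1 c.2
  let s : (m : ℕ) → {c : unitsKer p C // (p : Acris p C) ^ m ∣ u - logTeich p c} := fun m =>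
    Nat.rec ⟨1, by rw [pow_zero]; exact one_dvd _⟩ (fun m c => ⟨f m c, (hf m c).1⟩) m
  have hs : ∀ m, Perfection.coeff C p m (tiltVal (s (m + 1)).1) =
      Perfection.coeff C p m (tiltVal (s m).1) := fun m => (hf m (s m)).2
  -- The limit of the approximations is read off diagonally; `hs` makes the diagonal compatible with
  -- Frobenius.
  let x : Perfection C p := ⟨fun m => Perfection.coeff C p m (tiltVal (s m).1), fun m => by
    rw [Perfection.coeff_pow_p', hs]⟩
  have hx : ∀ m, Perfection.coeff C p m x = Perfection.coeff C p m (tiltVal (s m).1) :=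
    fun m => rfl
  obtain ⟨c, hc⟩ := exists_tiltVal_eq x (by rw [hx, coeff_zero_tiltVal])
  refine ⟨c, (sub_eq_zero.1 (eq_zero_of_forall_dvd fun m => ?_)).symm⟩
  -- The limit and the `m`-th approximation share their `m`-th coefficient, so their quotient is a
  -- `p^m`-th power and their logarithms agree modulo `p^m`.
  obtain ⟨e, he⟩ : ∃ e : unitsKer p C, c / (s m).1 = e ^ p ^ m := by
    refine exists_eq_pow_of_coeff_eq_one _ m ?_
    have h1 : tiltVal (c / (s m).1) * tiltVal (s m).1 = tiltVal c := by
      change tiltVal (c / (s m).1 * (s m).1) = _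
      rw [div_mul_cancel]
    have h2 := congrArg (Perfection.coeff C p m) h1
    rw [map_mul, hc, hx] at h2
    exact (((s m).1 : (Perfection C p)ˣ).isUnit.map (Perfection.coeff C p m)).mul_eq_right.1 h2
  have h3 : logTeich p c = logTeich p (s m).1 + (p : Acris p C) ^ m * logTeich p e := by
    have h4 := logTeich_div hA c (s m).1
    rw [he, logTeich_pow hA] at h4
    push_cast at h4
    rw [h4]
    ring
  rw [h3, ← sub_sub]
  exact dvd_sub (s m).2 (dvd_mul_right _ _)

/-- The logarithm is an isomorphism onto `A_cris(C)^{F = p}`. -/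
theorem exists_logEquiv (π : PerfPolynomial p B n →+* C)
    [hgp : IsGoodPresentation π] : ∃ e : Additive (unitsKer p C) ≃+ frobEqP p C,
    ∀ c : unitsKer p C, ((e (Additive.ofMul c) : frobEqP p C) : Acris p C) = logTeich p c := by
  have hA := eq_zero_of_p_mul π
  let f : Additive (unitsKer p C) →+ frobEqP p C :=
    (logHom hA).codRestrict (frobEqP p C) fun c => logTeich_mem_frobEqP hA c.toMul
  refine ⟨AddEquiv.ofBijective f ⟨?_, ?_⟩, fun c => rfl⟩
  · rw [injective_iff_map_eq_zero]
    intro c hc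
    exact eq_one_of_logTeich_eq_zero π c.toMul (congrArg Subtype.val hc)
  · rintro ⟨u, hu⟩
    obtain ⟨c, hc⟩ := exists_logTeich_eq π hu
    exact ⟨Additive.ofMul c, Subtype.ext hc⟩

end LogIso

end Acris

end

/-! ### The theorem for good algebras -/

theorem mainTheorem3 (p : ℕ) [Fact p.Prime] (k : Type v) [Field k] [CharP k p] [PerfectField k]
    (C : Type u) [CommRing C] [Algebra k C] [CharP C p] (hC : IsGoodAlgebra p k C) :
    ∃ e : Additive (Acris.unitsKer p C) ≃+ Acris.frobEqP p C,
      ∀ c : Acris.unitsKer p C,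
        ((e (Additive.ofMul c) : Acris.frobEqP p C) : Acris p C) = Acris.logTeich p c := by
  obtain ⟨B, _, _, _, n, ⟨φ⟩⟩ := hC
  have : Nontrivial C := CharP.nontrivial_of_char_ne_one (Fact.out : p.Prime).ne_one
  let π : PerfPolynomial p B n →+* C :=
    (φ.symm : PerfPolynomialQuotient p B n →+* C).comp (Ideal.Quotient.mk _)
  -- Nontriviality of `B` makes `k → B` injective, which gives `B` characteristic `p`.
  have : Nontrivial B := by
    by_contra h
    rw [not_nontrivial_iff_subsingleton] at h
    exact zero_ne_one (α := C) (by
      rw [← map_zero π, ← map_one π, Subsingleton.elim (0 : PerfPolynomial p B n) 1])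
  have : CharP B p := charP_of_injective_algebraMap (algebraMap k B).injective p
  have : IsGoodPresentation π :=
    { surjective := φ.symm.surjective.comp Ideal.Quotient.mk_surjective
      ker_eq := by
        ext r
        change φ.symm (Ideal.Quotient.mk _ r) = 0 ↔ _
        rw [EmbeddingLike.map_eq_zero_iff, Ideal.Quotient.eq_zero_iff_mem] }
  exact Acris.exists_logEquiv π
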